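/- Let $\Gamma=\mathbb Z^3\cup\bigl(\mathbb Z^3+(\tfrac12,\tfrac12,\tfrac12)\bigr)\subset\mathbb R^3$ be the body centered cubic lattice. A rotation $R\in SO(3)$ is a coincidence rotation of $\Gamma$ if $\Gamma\cap R\Gamma$ has finite index in $\Gamma$; the lattice $\Gamma\cap R\Gamma$ is then called an (ordinary) CSL. A multiple CSL is a lattice $\Gamma\cap R_1\Gamma\cap\dots\cap R_k\Gamma$ with coincidence rotations $R_1,\dots,R_k$ of $\Gamma$, $k\ge 1$. Let $f_2(\Sigma)$ be the number of distinct multiple CSLs of index $\Sigma$ in $\Gamma$ that are intersections of at most two ordinary CSLs. **Theorem.** Let $p$ be an odd prime number. Then for every integer $r\ge 1$ the number $f_2(p^r)$ is finite and $$f_2(p^r)=\Bigl(\frac r2+\frac12\Bigr)(p+1)p^{r-1}+\Bigl(\frac r2-1\Bigr)p^{r-2}-\Bigl(\frac r2-\Bigl[\frac r2\Bigr]\Bigr)p^{r-4}+\frac{p^{r-1}-p^{r-2[r/3]-1}}{p^2-1}+\frac{p^{4[r/3]-r+2}-p^{4[r/2]-r-2}}{2(p^2-1)},$$ where $[x]$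 denotes the largest integer $n$ with $n\le x$. Moreover, for $r=1,2$ we have $f_2(p^r)=f_m(p^r)$, where $f_m(p^r)$ denotes the number of multiple CSLs of index $p^r$ that are intersections of at most $m$ ordinary CSLs, for any $m\ge 2$; the same equality holds with $f_m(p^r)$ replaced by the number of all multiple CSLs of index $p^r$. -/

import Mathlib

open Matrix

/-- The image `R Γ` of an additive subgroup `Γ` of `ℝⁿ` under a rotation `R ∈ SO(n)`. -/
def rotatedCopy {n : ℕ} (R : specialOrthogonalGroup (Fin n) ℝ) (Γ : AddSubgroup (Fin n → ℝ)) :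
    AddSubgroup (Fin n → ℝ) :=
  Γ.map (Matrix.mulVecLin (R : Matrix (Fin n) (Fin n) ℝ)).toAddMonoidHom

/-- `R ∈ SO(n)` is a coincidence rotation of `Γ` if `Γ ∩ R Γ` has finite index in `Γ`. -/
def IsCoincidenceRotation {n : ℕ} (Γ : AddSubgroup (Fin n → ℝ))
    (R : specialOrthogonalGroup (Fin n) ℝ) : Prop :=
  (Γ ⊓ rotatedCopy R Γ).IsFiniteRelIndex Γ

/-- The multiple CSL `Γ(R₁, …, Rₘ) = Γ ∩ R₁ Γ ∩ … ∩ Rₘ Γ`. -/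
def multipleCSL {n m : ℕ} (Γ : AddSubgroup (Fin n → ℝ))
    (R : Fin m → specialOrthogonalGroup (Fin n) ℝ) : AddSubgroup (Fin n → ℝ) :=
  Γ ⊓ ⨅ i, rotatedCopy (R i) Γ

/-- `Λ` is the multiple CSL of `Γ` given by some `m` (not necessarily distinct) coincidence
rotations of `Γ`, i.e. `Λ` is an intersection of `m` ordinary CSLs. -/
def IsMultipleCSL {n : ℕ} (Γ : AddSubgroup (Fin n → ℝ)) (m : ℕ)
    (Λ : AddSubgroup (Fin n → ℝ)) : Prop :=
  ∃ R : Fin m → specialOrthogonalGroup (Fin n) ℝ,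
    (∀ i, IsCoincidenceRotation Γ (R i)) ∧ Λ = multipleCSL Γ R

/-- The set of multiple CSLs of `Γ` that have index `s` in `Γ` and are intersections of at most
`m` (and at least one) ordinary CSLs. -/
def multipleCSLsAtMost {n : ℕ} (Γ : AddSubgroup (Fin n → ℝ)) (m s : ℕ) :
    Set (AddSubgroup (Fin n → ℝ)) :=
  {Λ | (∃ k, 1 ≤ k ∧ k ≤ m ∧ IsMultipleCSL Γ k Λ) ∧ Λ.relIndex Γ = s}

/-- The set of all multiple CSLs of `Γ` (any positive number of rotations) of index `s` in `Γ`. -/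
def allMultipleCSLs {n : ℕ} (Γ : AddSubgroup (Fin n → ℝ)) (s : ℕ) :
    Set (AddSubgroup (Fin n → ℝ)) :=
  {Λ | (∃ k, 1 ≤ k ∧ IsMultipleCSL Γ k Λ) ∧ Λ.relIndex Γ = s}

/-- The body centered cubic lattice `ℤ³ + ℤ (1/2, 1/2, 1/2)`, i.e. `ℤ³ ∪ (ℤ³ + (1/2, 1/2, 1/2))`. -/
def bccLattice : AddSubgroup (Fin 3 → ℝ) where
  carrier := {x | ∃ (a : Fin 3 → ℤ) (k : ℤ), ∀ i, x i = (a i : ℝ) + (k : ℝ) / 2}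
  zero_mem' := ⟨0, 0, fun i => by simp⟩
  add_mem' := by
    rintro x y ⟨a, k, hx⟩ ⟨b, l, hy⟩
    refine ⟨a + b, k + l, fun i => ?_⟩
    simp only [Pi.add_apply, hx, hy]
    push_cast
    ring
  neg_mem' := by
    rintro x ⟨a, k, hx⟩
    refine ⟨-a, -k, fun i => ?_⟩
    simp only [Pi.neg_apply, hx]
    push_cast
    ring

/-!
The count rests on a local description of the coincidence site lattices of the body centered cubic
lattice `Γ` at the odd prime `p`.

**Binary quadratic forms.** Since `-1` is a sum of two squares modulo `p ^ N`, the lattice `ℤ³`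
with its dot product is isometric, modulo `p ^ N` and up to the factor `-4`, to the lattice of
binary quadratic forms with the polarized discriminant (`exists_isFormIsometry`). Isotropic lines modulo `p ^ n` become points
`ξ` of the projective line over `ℤ / p ^ n`, and the ordinary coincidence site lattices of index
`p ^ n` become the groups `formsVanishingAt p ξ n` of forms whose value at `ξ` is divisible by
`p ^ n`:

* If `p ^ n R` is integral and primitive, then it has rank one modulo `p ^ n`, because a rotation
  matrix is its own cofactor matrix; its columns span an isotropic line, and `Γ ∩ R Γ` is the
  orthogonal complement of this line modulo `p ^ n` (`exists_point_of_rotation`).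
* Conversely a point `ξ` defines a `p ^ n`-neighbour of `ℤ³`. It is unimodular, and every such
  lattice is a rotated copy of `ℤ³` (`exists_rotation_of_unimodular`): it is closed under the
  cross product, the pigeonhole principle provides a vector of norm `1` or `2`, and dividing a
  cross product by a norm yields unit vectors. Hence every point comes from a rotation
  (`exists_rotation_of_point`).

**Intersections.** It remains to count the groups of index `p ^ r` among the intersections of
`formsVanishingAt p ξ n` and `formsVanishingAt p η (m + c)`, where `m + c ≤ n` and the two points
agree exactly modulo `p ^ c` (or `m = 0`). Such an intersection has index `p ^ (n + m)`
(`HasMeet.index_inf`), and `HasMeet.inf_le_iff` determines all groups `formsVanishingAt p ζ l`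
that contain it. In the tree whose vertices of depth `n` are the points modulo `p ^ n`, these are
the vertices of a tube around a path, and the intersection determines the tube. If `m ≤ c`, this
amounts to `m` and a point modulo `p ^ (n - m)`; if `c < m`, to an unordered pair of points modulo
`p ^ (n - c)` and `p ^ m` that agree exactly modulo `p ^ c`. Counting points and pairs of points
gives `formIntersections_card`, and the closed form follows by a recursion from `r` to `r + 3`.

**Small exponents.** For `r ≤ 2`, a chain of subgroups of index dividing `p ^ r` is too short for
a third component to contribute (`mem_multipleCSLsAtMost_two`).
-/

/-! ### Unimodular lattices in three-space -/

/-- An additive subgroup of `ℝ³` is integral if all dot products of its elements are integers. -/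
def IsIntegralLattice (Λ : AddSubgroup (Fin 3 → ℝ)) : Prop :=
  ∀ x ∈ Λ, ∀ y ∈ Λ, ∃ k : ℤ, x ⬝ᵥ y = k

/-- `Λ` contains every vector whose dot products with all elements of `Λ` are integers. -/
def ContainsDual (Λ : AddSubgroup (Fin 3 → ℝ)) : Prop :=
  ∀ y : Fin 3 → ℝ, (∀ x ∈ Λ, ∃ k : ℤ, y ⬝ᵥ x = k) → y ∈ Λ

lemma dotProduct_fin_three (x y : Fin 3 → ℝ) :
    x ⬝ᵥ y = x 0 * y 0 + x 1 * y 1 + x 2 * y 2 := by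
  simp [dotProduct, Fin.sum_univ_three]

lemma dotProduct_self_pos_of_ne_zero {x : Fin 3 → ℝ} (hx : x ≠ 0) : 0 < x ⬝ᵥ x := by
  have h : 0 ≤ x ⬝ᵥ x := by
    rw [dotProduct_fin_three]
    exact add_nonneg (add_nonneg (mul_self_nonneg _) (mul_self_nonneg _)) (mul_self_nonneg _)
  refine lt_of_le_of_ne h fun h0 => hx ?_
  exact dotProduct_self_eq_zero.mp h0.symm

/-- A rational number whose square is an integer is an integer, in the form in which it is used for
the volume of a parallelepiped with vertices in `q⁻¹ ℤ³`. -/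
lemma exists_int_of_sq_eq_int {d : ℝ} {q w k : ℤ} (hq : q ≠ 0) (hw : (q : ℝ) * d = w)
    (hk : d ^ 2 = k) : ∃ l : ℤ, d = l := by
  have h1 : w ^ 2 = q ^ 2 * k := by
    have : (w : ℝ) ^ 2 = q ^ 2 * k := by rw [← hw, ← hk]; ring
    exact_mod_cast this
  have h2 : q ∣ w := by
    rw [← Int.pow_dvd_pow_iff two_ne_zero]
    exact ⟨k, h1⟩
  obtain ⟨l, rfl⟩ := h2
  refine ⟨l, ?_⟩
  have hq' : (q : ℝ) ≠ 0 := by exact_mod_cast hq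
  push_cast at hw
  exact mul_left_cancel₀ hq' hw

/-- A unimodular lattice commensurable with `ℤ³` is closed under the cross product: the triple
product of lattice vectors is rational and its square, a Gram determinant, is an integer. -/
lemma cross_mem {Λ : AddSubgroup (Fin 3 → ℝ)} (hint : IsIntegralLattice Λ)
    (hdual : ContainsDual Λ) {q : ℤ} (hq : q ≠ 0)
    (hrat : ∀ x ∈ Λ, ∃ z : Fin 3 → ℤ, ∀ i, (q : ℝ) * x i = z i) {x y : Fin 3 → ℝ}
    (hx : x ∈ Λ) (hy : y ∈ Λ) : x ⨯₃ y ∈ Λ := by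
  refine hdual _ fun z hz => ?_
  obtain ⟨a, ha⟩ := hrat x hx
  obtain ⟨b, hb⟩ := hrat y hy
  obtain ⟨c, hc⟩ := hrat z hz
  obtain ⟨xx, hxx⟩ := hint x hx x hx
  obtain ⟨yy, hyy⟩ := hint y hy y hy
  obtain ⟨zz, hzz⟩ := hint z hz z hz
  obtain ⟨xy, hxy⟩ := hint x hx y hy
  obtain ⟨xz, hxz⟩ := hint x hx z hz
  obtain ⟨yz, hyz⟩ := hint y hy z hz
  refine exists_int_of_sq_eq_int (q := q ^ 3)
    (w := (a 1 * b 2 - a 2 * b 1) * c 0 + (a 2 * b 0 - a 0 * b 2) * c 1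
      + (a 0 * b 1 - a 1 * b 0) * c 2)
    (k := xx * yy * zz + 2 * xy * yz * xz - xx * yz ^ 2 - yy * xz ^ 2 - zz * xy ^ 2)
    (pow_ne_zero _ hq) ?_ ?_
  · push_cast
    rw [← ha, ← ha, ← ha, ← hb, ← hb, ← hb, ← hc, ← hc, ← hc, dotProduct_fin_three]
    simp [cross_apply]
    ring
  · push_cast
    rw [← hxx, ← hyy, ← hzz, ← hxy, ← hxz, ← hyz]
    simp only [dotProduct_fin_three]
    simp [cross_apply]
    ring

/-- Any nonempty set of nonzero vectors of an integral lattice has a shortest element. -/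
lemma exists_min_norm {Λ : AddSubgroup (Fin 3 → ℝ)} (hint : IsIntegralLattice Λ)
    (P : (Fin 3 → ℝ) → Prop) (hP : ∃ x ∈ Λ, x ≠ 0 ∧ P x) :
    ∃ x ∈ Λ, x ≠ 0 ∧ P x ∧ ∀ y ∈ Λ, y ≠ 0 → P y → x ⬝ᵥ x ≤ y ⬝ᵥ y := by
  classical
  have hnat : ∀ x ∈ Λ, ∃ n : ℕ, x ⬝ᵥ x = n := by
    intro x hx
    obtain ⟨k, hk⟩ := hint x hx x hx
    have h0 : (0 : ℝ) ≤ k := by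
      rw [← hk, dotProduct_fin_three]
      exact add_nonneg (add_nonneg (mul_self_nonneg _) (mul_self_nonneg _)) (mul_self_nonneg _)
    refine ⟨k.toNat, ?_⟩
    rw [hk]
    have : ((k.toNat : ℤ) : ℝ) = k := by
      rw [Int.toNat_of_nonneg (by exact_mod_cast h0)]
    exact_mod_cast this.symm
  have hex : ∃ n : ℕ, ∃ x ∈ Λ, x ≠ 0 ∧ P x ∧ x ⬝ᵥ x = n := by
    obtain ⟨x, hx, hx0, hPx⟩ := hP
    obtain ⟨n, hn⟩ := hnat x hx
    exact ⟨n, x, hx, hx0, hPx, hn⟩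
  obtain ⟨x, hx, hx0, hPx, hxn⟩ := Nat.find_spec hex
  refine ⟨x, hx, hx0, hPx, fun y hy hy0 hPy => ?_⟩
  obtain ⟨n, hn⟩ := hnat y hy
  rw [hxn, hn]
  exact_mod_cast Nat.find_min' hex ⟨y, hy, hy0, hPy, hn⟩

lemma gram_identity_of_orthogonal {v w z : Fin 3 → ℝ} (hvw : v ⬝ᵥ w = 0) (hvz : v ⬝ᵥ z = 0) :
    (v ⬝ᵥ v) * (w ⬝ᵥ w) * (z ⬝ᵥ z) = (v ⬝ᵥ v) * (z ⬝ᵥ w) ^ 2 + (z ⬝ᵥ (v ⨯₃ w)) ^ 2 := by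
  have key : (v ⬝ᵥ v) * (w ⬝ᵥ w) * (z ⬝ᵥ z) + 2 * (v ⬝ᵥ w) * (z ⬝ᵥ w) * (v ⬝ᵥ z)
      - (w ⬝ᵥ w) * (v ⬝ᵥ z) ^ 2 - (z ⬝ᵥ z) * (v ⬝ᵥ w) ^ 2
      = (v ⬝ᵥ v) * (z ⬝ᵥ w) ^ 2 + (z ⬝ᵥ (v ⨯₃ w)) ^ 2 := by
    simp only [dotProduct_fin_three]
    simp [cross_apply]
    ring
  rw [← key, hvw, hvz]
  ring

/-- In a unimodular lattice that is closed under the cross product, let `v` have norm `m < 3` and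
let `w` be a shortest vector orthogonal to `v`, of norm `k`. The orthogonal complement of `v` is
spanned by `w` and `v ⨯₃ w`, because the remainder of division by `w` and `v ⨯₃ w` has norm at most
`(1 + m) k / 4 < k`. Hence `w ⨯₃ v` has dot products divisible by `k` and `(w ⨯₃ v) / k` is again a
lattice vector. -/
lemma exists_orthogonal_of_norm_lt_three {Λ : AddSubgroup (Fin 3 → ℝ)}
    (hint : IsIntegralLattice Λ) (hdual : ContainsDual Λ) {q : ℤ} (hq : q ≠ 0)
    (hrat : ∀ x ∈ Λ, ∃ z : Fin 3 → ℤ, ∀ i, (q : ℝ) * x i = z i)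
    {v : Fin 3 → ℝ} (hv : v ∈ Λ) (hv0 : v ≠ 0) (hv3 : v ⬝ᵥ v < 3) :
    ∃ w ∈ Λ, w ≠ 0 ∧ v ⬝ᵥ w = 0 ∧ (w ⬝ᵥ w)⁻¹ • (w ⨯₃ v) ∈ Λ := by
  have hcross : ∀ x ∈ Λ, ∀ y ∈ Λ, x ⨯₃ y ∈ Λ := fun x hx y hy =>
    cross_mem hint hdual hq hrat hx hy
  have hperp : ∃ x ∈ Λ, x ≠ 0 ∧ v ⬝ᵥ x = 0 := by
    have hqe : ∀ i, Pi.single i (q : ℝ) ∈ Λ := by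
      refine fun i => hdual _ fun x hx => ?_
      obtain ⟨z, hz⟩ := hrat x hx
      exact ⟨z i, by rw [single_dotProduct, hz]⟩
    by_contra! hcon
    have hzero : ∀ i, v ⨯₃ Pi.single i (q : ℝ) = 0 := fun i => by
      by_contra h
      exact hcon _ (hcross v hv _ (hqe i)) h (dot_self_cross _ _)
    have hq' : (q : ℝ) ≠ 0 := by exact_mod_cast hq
    have h0 := hzero 0
    have h1 := hzero 1
    rw [cross_apply] at h0 h1
    have h01 := congrFun h0 1
    have h02 := congrFun h0 2
    have h10 := congrFun h1 2
    simp [hq'] at h01 h02 h10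
    apply hv0
    funext i
    fin_cases i
    exacts [h10, h02, h01]
  obtain ⟨w, hw, hw0, hvw, hmin⟩ := exists_min_norm hint (fun x => v ⬝ᵥ x = 0) hperp
  refine ⟨w, hw, hw0, hvw, hdual _ fun x hx => ?_⟩
  have hkpos := dotProduct_self_pos_of_ne_zero hw0
  have hmpos := dotProduct_self_pos_of_ne_zero hv0
  set k := w ⬝ᵥ w with hk
  set m := v ⬝ᵥ v with hm
  set y := v ⨯₃ x with hy
  have hyΛ : y ∈ Λ := hcross v hv x hx
  have hvwΛ : v ⨯₃ w ∈ Λ := hcross v hv w hw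
  set b := round ((y ⬝ᵥ w) / k) with hb
  set c := round ((y ⬝ᵥ (v ⨯₃ w)) / (m * k)) with hc
  set z := y - b • w - c • (v ⨯₃ w) with hz
  have hzΛ : z ∈ Λ := Λ.sub_mem (Λ.sub_mem hyΛ (Λ.zsmul_mem hw b)) (Λ.zsmul_mem hvwΛ c)
  have hvz : v ⬝ᵥ z = 0 := by
    rw [hz, dotProduct_sub, dotProduct_sub, hy, dot_self_cross, dotProduct_smul, dotProduct_smul,
      dot_self_cross, hvw]
    simp
  have hzw : z ⬝ᵥ w = y ⬝ᵥ w - b * k := by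
    rw [hz, sub_dotProduct, sub_dotProduct, smul_dotProduct, smul_dotProduct,
      dotProduct_comm (v ⨯₃ w) w, dot_cross_self]
    simp [hk]
  have hzvw : z ⬝ᵥ (v ⨯₃ w) = y ⬝ᵥ (v ⨯₃ w) - c * (m * k) := by
    have hnorm : (v ⨯₃ w) ⬝ᵥ (v ⨯₃ w) = m * k := by
      rw [cross_dot_cross, hvw, dotProduct_comm w v, hvw]
      ring
    rw [hz, sub_dotProduct, sub_dotProduct, smul_dotProduct, smul_dotProduct, hnorm,
      dot_cross_self]
    simp
  have hb1 : (z ⬝ᵥ w) ^ 2 ≤ k ^ 2 / 4 := by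
    have h := abs_sub_round ((y ⬝ᵥ w) / k)
    have h2 : z ⬝ᵥ w = ((y ⬝ᵥ w) / k - b) * k := by rw [hzw]; field_simp
    have h3 : ((y ⬝ᵥ w) / k - b) ^ 2 ≤ (1 / 2) ^ 2 := by
      rw [← sq_abs]; exact pow_le_pow_left₀ (abs_nonneg _) h 2
    rw [h2, mul_pow]
    nlinarith [mul_le_mul_of_nonneg_right h3 (sq_nonneg k)]
  have hc1 : (z ⬝ᵥ (v ⨯₃ w)) ^ 2 ≤ (m * k) ^ 2 / 4 := by
    have h := abs_sub_round ((y ⬝ᵥ (v ⨯₃ w)) / (m * k))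
    have h2 : z ⬝ᵥ (v ⨯₃ w) = ((y ⬝ᵥ (v ⨯₃ w)) / (m * k) - c) * (m * k) := by
      rw [hzvw]; field_simp
    have h3 : ((y ⬝ᵥ (v ⨯₃ w)) / (m * k) - c) ^ 2 ≤ (1 / 2) ^ 2 := by
      rw [← sq_abs]; exact pow_le_pow_left₀ (abs_nonneg _) h 2
    rw [h2, mul_pow]
    nlinarith [mul_le_mul_of_nonneg_right h3 (sq_nonneg (m * k))]
  have hzlt : z ⬝ᵥ z < k := by
    have hg := gram_identity_of_orthogonal hvw hvz
    have h1 : (m * k) * (z ⬝ᵥ z) ≤ (m * k) * (k * (1 + m) / 4) := by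
      rw [hg]
      nlinarith [mul_le_mul_of_nonneg_left hb1 hmpos.le]
    have h2 := le_of_mul_le_mul_left h1 (mul_pos hmpos hkpos)
    nlinarith
  have hz0 : z = 0 := by
    by_contra h
    exact absurd (hmin z hzΛ h hvz) (not_le.mpr hzlt)
  have hyw : y ⬝ᵥ w = b * k := by
    rw [hz0, zero_dotProduct] at hzw
    linarith
  refine ⟨b, ?_⟩
  have htriple : (w ⨯₃ v) ⬝ᵥ x = y ⬝ᵥ w := by
    rw [hy, dotProduct_comm (w ⨯₃ v), triple_product_permutation, dotProduct_comm]
  rw [smul_dotProduct, htriple, hyw, smul_eq_mul]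
  field_simp

lemma exists_norm_one {Λ : AddSubgroup (Fin 3 → ℝ)}
    (hint : IsIntegralLattice Λ) (hdual : ContainsDual Λ) {q : ℤ} (hq : q ≠ 0)
    (hrat : ∀ x ∈ Λ, ∃ z : Fin 3 → ℤ, ∀ i, (q : ℝ) * x i = z i)
    (hshort : ∃ v ∈ Λ, v ≠ 0 ∧ v ⬝ᵥ v < 3) :
    ∃ v ∈ Λ, v ⬝ᵥ v = 1 := by
  obtain ⟨v, hv, hv0, hv3⟩ := hshort
  obtain ⟨w, hw, hw0, hvw, hu⟩ := exists_orthogonal_of_norm_lt_three hint hdual hq hrat hv hv0 hv3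
  obtain ⟨m, hm⟩ := hint v hv v hv
  obtain ⟨k, hk⟩ := hint w hw w hw
  obtain ⟨l, hl⟩ := hint _ hu _ hu
  have hmpos : 0 < m := by exact_mod_cast hm ▸ dotProduct_self_pos_of_ne_zero hv0
  have hkpos : 0 < k := by exact_mod_cast hk ▸ dotProduct_self_pos_of_ne_zero hw0
  have hm3 : m < 3 := by exact_mod_cast hm ▸ hv3
  have hkl : k * l = m := by
    have hk' : (k : ℝ) ≠ 0 := by exact_mod_cast hkpos.ne'
    have h1 : (k : ℝ) * l = m := by
      rw [← hl, smul_dotProduct, dotProduct_smul, cross_dot_cross, hvw, dotProduct_comm w v, hvw,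
        hk, hm]
      simp only [smul_eq_mul]
      field_simp
      ring
    exact_mod_cast h1
  rcases (by omega : m = 1 ∨ m = 2) with rfl | rfl
  · exact ⟨v, hv, by rw [hm]; simp⟩
  · -- `k * l = 2`, so that `w` or `(w ⨯₃ v) / k` is a unit vector
    have hk2 : k ≤ 2 := Int.le_of_dvd (by norm_num) ⟨l, hkl.symm⟩
    rcases (by omega : k = 1 ∨ k = 2) with rfl | rfl
    · exact ⟨w, hw, by rw [hk]; simp⟩
    · exact ⟨_, hu, by rw [hl]; exact_mod_cast (by omega : l = 1)⟩

/-- A unimodular lattice commensurable with `ℤ³` that has a nonzero vector of norm less than `3` is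
the image of `ℤ³` under a rotation. -/
theorem exists_rotation_of_unimodular {Λ : AddSubgroup (Fin 3 → ℝ)}
    (hint : IsIntegralLattice Λ) (hdual : ContainsDual Λ) {q : ℤ} (hq : q ≠ 0)
    (hrat : ∀ x ∈ Λ, ∃ z : Fin 3 → ℤ, ∀ i, (q : ℝ) * x i = z i)
    (hshort : ∃ v ∈ Λ, v ≠ 0 ∧ v ⬝ᵥ v < 3) :
    ∃ R ∈ specialOrthogonalGroup (Fin 3) ℝ,
      ∀ x, x ∈ Λ ↔ ∃ z : Fin 3 → ℤ, Rᵀ *ᵥ x = fun i => (z i : ℝ) := by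
  obtain ⟨v, hv, hv1⟩ := exists_norm_one hint hdual hq hrat hshort
  have hv0 : v ≠ 0 := by
    rintro rfl
    simp at hv1
  obtain ⟨w, hw, hw0, hvw, hu⟩ :=
    exists_orthogonal_of_norm_lt_three hint hdual hq hrat hv hv0 (by rw [hv1]; norm_num)
  have hw1 : w ⬝ᵥ w = 1 := by
    obtain ⟨k, hk⟩ := hint w hw w hw
    obtain ⟨l, hl⟩ := hint _ hu _ hu
    have hkpos : 0 < k := by exact_mod_cast hk ▸ dotProduct_self_pos_of_ne_zero hw0
    have hk' : (k : ℝ) ≠ 0 := by exact_mod_cast hkpos.ne'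
    have hkl : k * l = 1 := by
      have h1 : (k : ℝ) * l = 1 := by
        rw [← hl, smul_dotProduct, dotProduct_smul, cross_dot_cross, hvw, dotProduct_comm w v,
          hvw, hk, hv1]
        simp only [smul_eq_mul]
        field_simp
        ring
      exact_mod_cast h1
    have : k = 1 := by
      have := Int.le_of_dvd one_pos ⟨l, hkl.symm⟩
      omega
    rw [hk, this]
    simp
  have huΛ : v ⨯₃ w ∈ Λ := cross_mem hint hdual hq hrat hv hw
  set u := v ⨯₃ w with hu_def
  have hvu : v ⬝ᵥ u = 0 := dot_self_cross _ _
  have hwu : w ⬝ᵥ u = 0 := dot_cross_self _ _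
  have huu : u ⬝ᵥ u = 1 := by
    rw [hu_def, cross_dot_cross, hvw, dotProduct_comm w v, hvw, hv1, hw1]
    ring
  -- the rotation has columns `v`, `w`, `v ⨯₃ w`
  set S : Matrix (Fin 3) (Fin 3) ℝ := Matrix.of ![v, w, u] with hS
  have hSS : S * Sᵀ = 1 := by
    ext i j
    have hentry : (S * Sᵀ) i j = ![v, w, u] i ⬝ᵥ ![v, w, u] j := rfl
    rw [hentry]
    fin_cases i <;> fin_cases j <;>
      simp [hv1, hw1, huu, hvw, hvu, hwu, dotProduct_comm w v, dotProduct_comm u v,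
        dotProduct_comm u w]
  have hdet : S.det = 1 := by
    have h1 : S.det = u ⬝ᵥ v ⨯₃ w := by
      rw [triple_product_permutation u v w]
      exact (triple_product_eq_det v w u).symm
    rw [h1, ← hu_def, huu]
  have hSS' : Sᵀ * S = 1 := mul_eq_one_comm.mp hSS
  refine ⟨Sᵀ, ?_, fun x => ?_⟩
  · rw [mem_specialOrthogonalGroup_iff, mem_orthogonalGroup_iff]
    refine ⟨?_, by rw [det_transpose, hdet]⟩
    simpa [star_eq_conjTranspose] using hSS'
  rw [transpose_transpose]
  have hSx : S *ᵥ x = ![v ⬝ᵥ x, w ⬝ᵥ x, u ⬝ᵥ x] := by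
    funext i
    fin_cases i <;> rfl
  constructor
  · intro hx
    obtain ⟨a, ha⟩ := hint v hv x hx
    obtain ⟨b, hb⟩ := hint w hw x hx
    obtain ⟨c, hc⟩ := hint u huΛ x hx
    refine ⟨![a, b, c], ?_⟩
    rw [hSx, ha, hb, hc]
    funext i
    fin_cases i <;> simp
  · rintro ⟨z, hz⟩
    have hx : x = z 0 • v + z 1 • w + z 2 • u := by
      have h1 : x = Sᵀ *ᵥ (S *ᵥ x) := by rw [mulVec_mulVec, hSS', one_mulVec]
      rw [h1, hz]
      funext i
      rw [mulVec, dotProduct_fin_three]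
      simp [hS]
      ring
    rw [hx]
    exact Λ.add_mem (Λ.add_mem (Λ.zsmul_mem hv _) (Λ.zsmul_mem hw _)) (Λ.zsmul_mem huΛ _)

/-! ### Binary quadratic forms vanishing at a point to a given order -/

/-- The binary quadratic form `v.1 X² + v.2.1 X Y + v.2.2 Y²` evaluated at `ξ`. -/
def formEval (v : ℤ × ℤ × ℤ) (ξ : ℤ × ℤ) : ℤ :=
  v.1 * ξ.1 ^ 2 + v.2.1 * (ξ.1 * ξ.2) + v.2.2 * ξ.2 ^ 2

/-- The polar form of `formEval`, so that `formPolar v ξ ξ = 2 * formEval v ξ`. -/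
def formPolar (v : ℤ × ℤ × ℤ) (ξ η : ℤ × ℤ) : ℤ :=
  2 * v.1 * (ξ.1 * η.1) + v.2.1 * (ξ.1 * η.2 + ξ.2 * η.1) + 2 * v.2.2 * (ξ.2 * η.2)

/-- The determinant of two vectors in the plane. For coprime vectors, `p ^ n` divides it exactly
when the two vectors define the same point of the projective line over `ℤ / p ^ n`. -/
def pairDet (ξ η : ℤ × ℤ) : ℤ := ξ.1 * η.2 - ξ.2 * η.1

/-- The group of integral binary quadratic forms whose value at `ξ` is divisible by `p ^ n`. -/
def formsVanishingAt (p : ℕ) (ξ : ℤ × ℤ) (n : ℕ) : AddSubgroup (ℤ × ℤ × ℤ) where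
  carrier := {v | (p : ℤ) ^ n ∣ formEval v ξ}
  zero_mem' := by simp [formEval]
  add_mem' := by
    intro v w hv hw
    have h : formEval (v + w) ξ = formEval v ξ + formEval w ξ := by
      simp only [formEval, Prod.fst_add, Prod.snd_add]; ring
    simp only [Set.mem_ofPred_eq] at hv hw ⊢
    rw [h]
    exact dvd_add hv hw
  neg_mem' := by
    intro v hv
    have h : formEval (-v) ξ = -formEval v ξ := by
      simp only [formEval, Prod.fst_neg, Prod.snd_neg]; ring
    simp only [Set.mem_ofPred_eq] at hv ⊢
    rw [h]
    exact hv.neg_right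

lemma mem_formsVanishingAt {p : ℕ} {ξ : ℤ × ℤ} {n : ℕ} {v : ℤ × ℤ × ℤ} :
    v ∈ formsVanishingAt p ξ n ↔ (p : ℤ) ^ n ∣ formEval v ξ := Iff.rfl

/-- The form that has coefficients `a`, `b`, `c` in a basis `ξ`, `ξ'` of determinant one. -/
def formOfBasis (ξ ξ' : ℤ × ℤ) (a b c : ℤ) : ℤ × ℤ × ℤ :=
  (a * ξ'.2 ^ 2 - b * (ξ'.2 * ξ.2) + c * ξ.2 ^ 2,
    -2 * a * (ξ'.1 * ξ'.2) + b * (ξ'.2 * ξ.1 + ξ'.1 * ξ.2) - 2 * c * (ξ.1 * ξ.2),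
    a * ξ'.1 ^ 2 - b * (ξ'.1 * ξ.1) + c * ξ.1 ^ 2)

lemma formEval_formOfBasis (ξ ξ' η : ℤ × ℤ) (a b c : ℤ) :
    formEval (formOfBasis ξ ξ' a b c) η =
      a * pairDet η ξ' ^ 2 + b * (pairDet η ξ' * pairDet ξ η) + c * pairDet ξ η ^ 2 := by
  simp only [formEval, formOfBasis, pairDet]; ring

lemma formPolar_formOfBasis (ξ ξ' : ℤ × ℤ) (a b c : ℤ) :
    formPolar (formOfBasis ξ ξ' a b c) ξ ξ' = b * pairDet ξ ξ' ^ 2 := by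
  simp only [formPolar, formOfBasis, pairDet]; ring

lemma pairDet_self (ξ : ℤ × ℤ) : pairDet ξ ξ = 0 := by simp only [pairDet]; ring

lemma pairDet_swap (ξ η : ℤ × ℤ) : pairDet ξ η = -pairDet η ξ := by simp only [pairDet]; ring

/-- The coefficients of a form in a basis of determinant one. -/
lemma formEval_eq_of_pairDet_eq_one {ξ ξ' : ℤ × ℤ} (h : pairDet ξ ξ' = 1) (v : ℤ × ℤ × ℤ)
    (η : ℤ × ℤ) :
    formEval v η = formEval v ξ * pairDet η ξ' ^ 2
      + formPolar v ξ ξ' * (pairDet η ξ' * pairDet ξ η) + formEval v ξ' * pairDet ξ η ^ 2 := by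
  have key : pairDet ξ ξ' ^ 2 * formEval v η = formEval v ξ * pairDet η ξ' ^ 2
      + formPolar v ξ ξ' * (pairDet η ξ' * pairDet ξ η) + formEval v ξ' * pairDet ξ η ^ 2 := by
    simp only [formEval, formPolar, pairDet]; ring
  rw [← key, h]; ring

lemma pairDet_eq_of_pairDet_eq_one {ξ ξ' : ℤ × ℤ} (h : pairDet ξ ξ' = 1) (η ζ : ℤ × ℤ) :
    pairDet η ζ = pairDet η ξ' * pairDet ξ ζ - pairDet ξ η * pairDet ζ ξ' := by
  have key : pairDet ξ ξ' * pairDet η ζ =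
      pairDet η ξ' * pairDet ξ ζ - pairDet ξ η * pairDet ζ ξ' := by
    simp only [pairDet]; ring
  rw [← key, h, one_mul]

lemma exists_pairDet_eq_one {ξ : ℤ × ℤ} (h : IsCoprime ξ.1 ξ.2) : ∃ ξ', pairDet ξ ξ' = 1 := by
  obtain ⟨a, b, hab⟩ := h
  exact ⟨(-b, a), by simp only [pairDet]; linarith⟩

lemma isCoprime_of_pairDet_eq_one {ξ ξ' : ℤ × ℤ} (h : pairDet ξ ξ' = 1) :
    IsCoprime ξ.1 ξ.2 :=
  ⟨ξ'.2, -ξ'.1, by simp only [pairDet] at h; linarith⟩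

lemma isCoprime_coords {ξ ξ' η : ℤ × ℤ} (h : pairDet ξ ξ' = 1) (hη : IsCoprime η.1 η.2) :
    IsCoprime (pairDet η ξ') (pairDet ξ η) := by
  obtain ⟨η', hη'⟩ := exists_pairDet_eq_one hη
  refine ⟨pairDet ξ η', -pairDet η' ξ', ?_⟩
  rw [← hη', pairDet_eq_of_pairDet_eq_one h η η']; ring

lemma dvd_of_dvd_mul_of_isCoprime {d a b x : ℤ} (h : IsCoprime a b) (ha : d ∣ a * x)
    (hb : d ∣ b * x) : d ∣ x := by
  obtain ⟨s, t, hst⟩ := h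
  have : x = s * (a * x) + t * (b * x) := by linear_combination (-x) * hst
  rw [this]
  exact dvd_add (ha.mul_left s) (hb.mul_left t)

/-- Agreement of points modulo `d` is transitive. -/
lemma dvd_pairDet_trans {d : ℤ} {ξ η ζ : ℤ × ℤ} (hη : IsCoprime η.1 η.2)
    (h1 : d ∣ pairDet ξ η) (h2 : d ∣ pairDet η ζ) : d ∣ pairDet ξ ζ := by
  refine dvd_of_dvd_mul_of_isCoprime hη ?_ ?_
  · have : η.1 * pairDet ξ ζ = ζ.1 * pairDet ξ η + ξ.1 * pairDet η ζ := by
      simp only [pairDet]; ring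
    rw [this]
    exact dvd_add (h1.mul_left _) (h2.mul_left _)
  · have : η.2 * pairDet ξ ζ = ζ.2 * pairDet ξ η + ξ.2 * pairDet η ζ := by
      simp only [pairDet]; ring
    rw [this]
    exact dvd_add (h1.mul_left _) (h2.mul_left _)

lemma dvd_pairDet_comm {d : ℤ} {ξ η : ℤ × ℤ} : d ∣ pairDet ξ η ↔ d ∣ pairDet η ξ := by
  rw [pairDet_swap, dvd_neg]

section
variable {p : ℕ}

/-- `HasMeet p ξ η n m c` records the position of two points `ξ`, `η` of levels `n` and `m + c ≤ n`:
they agree exactly modulo `p ^ c`, or, if `m = 0`, at least modulo `p ^ c`. -/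
structure HasMeet (p : ℕ) (ξ η : ℤ × ℤ) (n m c : ℕ) : Prop where
  left : IsCoprime ξ.1 ξ.2
  right : IsCoprime η.1 η.2
  le : m + c ≤ n
  dvd : (p : ℤ) ^ c ∣ pairDet ξ η
  exact : m = 0 ∨ ¬ (p : ℤ) ^ (c + 1) ∣ pairDet ξ η

/-- In a basis `ξ`, `ξ'`, the two conditions on a form become a condition on its first coefficient
and a linear condition on the other two coefficients. -/
lemma HasMeet.mem_inf_iff (hp : p.Prime) {ξ ξ' η : ℤ × ℤ} {n m c : ℕ} (h : HasMeet p ξ η n m c)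
    (hξ : pairDet ξ ξ' = 1) (v : ℤ × ℤ × ℤ) :
    v ∈ formsVanishingAt p ξ n ⊓ formsVanishingAt p η (m + c) ↔
      (p : ℤ) ^ n ∣ formEval v ξ ∧
        (p : ℤ) ^ m ∣ pairDet η ξ' * formPolar v ξ ξ' + pairDet ξ η * formEval v ξ' := by
  rw [AddSubgroup.mem_inf, mem_formsVanishingAt, mem_formsVanishingAt]
  refine and_congr_right fun hn => ?_
  have hpp : Prime (p : ℤ) := Nat.prime_iff_prime_int.mp hp
  have hn' : (p : ℤ) ^ (m + c) ∣ formEval v ξ * pairDet η ξ' ^ 2 :=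
    ((pow_dvd_pow _ h.le).trans hn).mul_right _
  have heq : formEval v η = formEval v ξ * pairDet η ξ' ^ 2 + pairDet ξ η *
      (pairDet η ξ' * formPolar v ξ ξ' + pairDet ξ η * formEval v ξ') := by
    rw [formEval_eq_of_pairDet_eq_one hξ v η]; ring
  rw [heq, dvd_add_right hn']
  rcases h.exact with rfl | hex
  · simpa using h.dvd.mul_right _
  · obtain ⟨d, hd⟩ := h.dvd
    have hpd : ¬ (p : ℤ) ∣ d := by
      rintro ⟨k, rfl⟩
      exact hex ⟨k, by rw [hd]; ring⟩
    have hpc : (p : ℤ) ^ c ≠ 0 := pow_ne_zero _ hpp.ne_zero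
    nth_rw 1 [hd]
    rw [pow_add, mul_comm ((p : ℤ) ^ m), mul_assoc, mul_dvd_mul_iff_left hpc]
    exact ⟨fun h => hpp.pow_dvd_of_dvd_mul_left _ hpd h, fun h => h.mul_left _⟩

lemma HasMeet.index_inf (hp : p.Prime) {ξ η : ℤ × ℤ} {n m c : ℕ} (h : HasMeet p ξ η n m c) :
    (formsVanishingAt p ξ n ⊓ formsVanishingAt p η (m + c)).index = p ^ (n + m) := by
  obtain ⟨ξ', hξ'⟩ := exists_pairDet_eq_one h.left
  have : NeZero (p ^ n) := ⟨pow_ne_zero _ hp.ne_zero⟩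
  have : NeZero (p ^ m) := ⟨pow_ne_zero _ hp.ne_zero⟩
  let ψ : ℤ × ℤ × ℤ →+ ZMod (p ^ n) × ZMod (p ^ m) := AddMonoidHom.mk'
    (fun v => ((formEval v ξ : ℤ),
      ((pairDet η ξ' * formPolar v ξ ξ' + pairDet ξ η * formEval v ξ' : ℤ) : ZMod (p ^ m))))
    (by
      intro v w
      ext
      · simp only [formEval, Prod.fst_add, Prod.snd_add]; push_cast; ring
      · simp only [formEval, formPolar, Prod.fst_add, Prod.snd_add]; push_cast; ring)
  have hker : ψ.ker = formsVanishingAt p ξ n ⊓ formsVanishingAt p η (m + c) := by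
    ext v
    rw [h.mem_inf_iff hp hξ', AddMonoidHom.mem_ker]
    simp only [ψ, AddMonoidHom.mk'_apply, Prod.mk_eq_zero, ZMod.intCast_zmod_eq_zero_iff_dvd]
    push_cast
    rfl
  have hsurj : Function.Surjective ψ := by
    rintro ⟨a, b⟩
    obtain ⟨a, rfl⟩ := ZMod.intCast_surjective a
    obtain ⟨b, rfl⟩ := ZMod.intCast_surjective b
    obtain ⟨s, t, hst⟩ := isCoprime_coords hξ' h.right
    refine ⟨formOfBasis ξ ξ' a (b * s) (b * t), ?_⟩
    simp only [ψ, AddMonoidHom.mk'_apply, formEval_formOfBasis, formPolar_formOfBasis, hξ',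
      pairDet_self]
    ext
    · simp
    · simp only
      congr 1
      linear_combination b * hst
  rw [← hker, AddSubgroup.index_ker, AddMonoidHom.range_eq_top.mpr hsurj, AddSubgroup.card_top,
    Nat.card_prod, Nat.card_zmod, Nat.card_zmod, pow_add]

/-- The points at which all forms of an intersection vanish to a prescribed order. In terms of the
tree of the projective line, these are the vertices of a tube around a path. -/
lemma HasMeet.inf_le_iff (hp : p.Prime) {ξ η ζ : ℤ × ℤ} {n m c l : ℕ} (h : HasMeet p ξ η n m c)
    (hζ : IsCoprime ζ.1 ζ.2) :
    formsVanishingAt p ξ n ⊓ formsVanishingAt p η (m + c) ≤ formsVanishingAt p ζ l ↔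
      l ≤ n ∧ (p : ℤ) ^ l ∣ p ^ m * pairDet ξ ζ ∧ (p : ℤ) ^ l ∣ pairDet ξ ζ * pairDet η ζ := by
  obtain ⟨ξ', hξ'⟩ := exists_pairDet_eq_one h.left
  have hpp : Prime (p : ℤ) := Nat.prime_iff_prime_int.mp hp
  have hcop := isCoprime_coords hξ' h.right
  have hcop' := isCoprime_coords hξ' hζ
  set α := pairDet η ξ' with hα
  set β := pairDet ξ η with hβ
  set γ := pairDet ζ ξ' with hγ
  set δ := pairDet ξ ζ with hδ
  have hD : pairDet η ζ = α * δ - β * γ := pairDet_eq_of_pairDet_eq_one hξ' η ζ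
  constructor
  · intro hle
    have hform : ∀ a b c' : ℤ, (p : ℤ) ^ n ∣ a → (p : ℤ) ^ m ∣ α * b + β * c' →
        (p : ℤ) ^ l ∣ a * γ ^ 2 + b * (γ * δ) + c' * δ ^ 2 := by
      intro a b c' ha hb
      have h1 := hle ((h.mem_inf_iff hp hξ' (formOfBasis ξ ξ' a b c')).mpr ?_)
      · rw [mem_formsVanishingAt, formEval_formOfBasis] at h1
        exact h1
      · simp only [formEval_formOfBasis, formPolar_formOfBasis, hξ', pairDet_self]
        constructor
        · simpa using ha
        · simpa using hb
    have h1 := hform (p ^ n) 0 0 dvd_rfl (by simp)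
    have h2 := hform 0 β (-α) (by simp) (by rw [show α * β + β * -α = 0 by ring]; simp)
    have h3 := hform 0 (p ^ m) 0 (by simp) (by simp)
    have h4 := hform 0 0 (p ^ m) (by simp) (by simp)
    have h5 : (p : ℤ) ^ l ∣ p ^ m * δ := by
      refine dvd_of_dvd_mul_of_isCoprime hcop' ?_ ?_
      · convert h3 using 1; ring
      · convert h4 using 1; ring
    refine ⟨?_, h5, ?_⟩
    · have hle_of : ∀ k, (p : ℤ) ^ l ∣ p ^ k → l ≤ k := fun k hk =>
        (pow_dvd_pow_iff hpp.ne_zero hpp.not_isUnit).mp hk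
      by_cases hpγ : (p : ℤ) ∣ γ
      · have hpδ : ¬ (p : ℤ) ∣ δ := fun hpδ =>
          hpp.not_isUnit (hcop'.isUnit_of_dvd' hpγ hpδ)
        have := hle_of m (hpp.pow_dvd_of_dvd_mul_right _ hpδ h5)
        have := h.le
        omega
      · refine hle_of n (hpp.pow_dvd_of_dvd_mul_right l (b := γ ^ 2) ?_ ?_)
        · exact fun hh => hpγ (hpp.dvd_of_dvd_pow hh)
        · simpa using h1
    · have h6 : δ * pairDet η ζ = -(0 * γ ^ 2 + β * (γ * δ) + -α * δ ^ 2) := by rw [hD]; ring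
      rw [h6, dvd_neg]
      exact h2
  · rintro ⟨hln, h1, h2⟩ v hv
    rw [h.mem_inf_iff hp hξ'] at hv
    obtain ⟨ha, k, hk⟩ := hv
    rw [mem_formsVanishingAt, formEval_eq_of_pairDet_eq_one hξ' v ζ]
    have ha' : (p : ℤ) ^ l ∣ formEval v ξ * γ ^ 2 :=
      ((pow_dvd_pow _ hln).trans ha).mul_right _
    rw [add_assoc]
    refine dvd_add ha' ?_
    set B := formPolar v ξ ξ'
    set C := formEval v ξ'
    rw [hD] at h2
    refine dvd_of_dvd_mul_of_isCoprime hcop ?_ ?_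
    · have : α * (B * (γ * δ) + C * δ ^ 2) =
          (p ^ m * δ) * (γ * k) + (δ * (α * δ - β * γ)) * C := by
        linear_combination γ * δ * hk
      rw [this]
      exact dvd_add (h1.mul_right _) (h2.mul_right _)
    · have : β * (B * (γ * δ) + C * δ ^ 2) =
          (p ^ m * δ) * (δ * k) - (δ * (α * δ - β * γ)) * B := by
        linear_combination δ ^ 2 * hk
      rw [this]
      exact dvd_sub (h1.mul_right _) (h2.mul_right _)

end

/-! ### Coincidences among intersections of two groups of forms -/

section
variable {p : ℕ}

lemma HasMeet.symm_of_eq {ξ η : ℤ × ℤ} {m c : ℕ} (h : HasMeet p ξ η (m + c) m c) :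
    HasMeet p η ξ (m + c) m c :=
  ⟨h.right, h.left, le_rfl, dvd_pairDet_comm.mp h.dvd,
    h.exact.imp_right fun hn hd => hn (dvd_pairDet_comm.mp hd)⟩

lemma pow_dvd_of_pow_add_dvd_mul (hp : p.Prime) {x y : ℤ} {a c : ℕ}
    (h : (p : ℤ) ^ (a + c) ∣ x * y) (hy : ¬ (p : ℤ) ^ (c + 1) ∣ y) : (p : ℤ) ^ a ∣ x := by
  have hpp : Prime (p : ℤ) := Nat.prime_iff_prime_int.mp hp
  have hfin : FiniteMultiplicity (p : ℤ) y := by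
    refine Int.finiteMultiplicity_iff.mpr ⟨?_, ?_⟩
    · simpa using hp.ne_one
    · rintro rfl
      exact hy (dvd_zero _)
  obtain ⟨k, hk, hpk⟩ := hfin.exists_eq_pow_mul_and_not_dvd
  have hle : multiplicity (p : ℤ) y ≤ c := by
    by_contra! hlt
    exact hy ((pow_dvd_pow _ hlt).trans ⟨k, hk⟩)
  obtain ⟨e, he⟩ := Nat.exists_eq_add_of_le hle
  have h2 : (p : ℤ) ^ multiplicity (p : ℤ) y * p ^ (a + e) ∣
      p ^ multiplicity (p : ℤ) y * (x * k) := by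
    refine (dvd_of_eq ?_).trans (h.trans (dvd_of_eq ?_))
    · rw [← pow_add]; congr 1; omega
    · nth_rw 1 [hk]; ring
  rw [mul_dvd_mul_iff_left (pow_ne_zero _ hpp.ne_zero)] at h2
  exact (pow_dvd_pow _ (Nat.le_add_right a e)).trans (hpp.pow_dvd_of_dvd_mul_right _ hpk h2)

lemma pow_dvd_of_pow_dvd_pow_mul (hp : p.Prime) {x : ℤ} {n m : ℕ}
    (h : (p : ℤ) ^ n ∣ p ^ m * x) : (p : ℤ) ^ (n - m) ∣ x := by
  rcases le_total n m with hnm | hnm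
  · simp [Nat.sub_eq_zero_of_le hnm]
  · obtain ⟨k, rfl⟩ := Nat.exists_eq_add_of_le hnm
    rw [pow_add, mul_dvd_mul_iff_left (pow_ne_zero _ (by exact_mod_cast hp.ne_zero))] at h
    rwa [Nat.add_sub_cancel_left]

lemma HasMeet.level_eq (hp : p.Prime) {ξ η ξ₁ η₁ : ℤ × ℤ} {n m c n₁ m₁ c₁ : ℕ}
    (h : HasMeet p ξ η n m c) (h₁ : HasMeet p ξ₁ η₁ n₁ m₁ c₁)
    (heq : formsVanishingAt p ξ n ⊓ formsVanishingAt p η (m + c) =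
      formsVanishingAt p ξ₁ n₁ ⊓ formsVanishingAt p η₁ (m₁ + c₁)) : n = n₁ ∧ m = m₁ := by
  have hn : n = n₁ := le_antisymm
    ((h₁.inf_le_iff hp h.left).mp (heq.ge.trans inf_le_left)).1
    ((h.inf_le_iff hp h₁.left).mp (heq.le.trans inf_le_left)).1
  refine ⟨hn, ?_⟩
  have hi := h.index_inf hp
  rw [heq, h₁.index_inf hp] at hi
  have := Nat.pow_right_injective hp.two_le hi
  omega

/-- If `m ≤ c`, the intersection depends only on `n`, `m` and the first point modulo
`p ^ (n - m)`. -/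
lemma HasMeet.inf_eq_of_le (hp : p.Prime) {ξ η ξ₁ η₁ : ℤ × ℤ} {n m c c₁ : ℕ}
    (h : HasMeet p ξ η n m c) (h₁ : HasMeet p ξ₁ η₁ n m c₁) (hmc : m ≤ c) (hmc₁ : m ≤ c₁)
    (hξ : (p : ℤ) ^ (n - m) ∣ pairDet ξ ξ₁) :
    formsVanishingAt p ξ n ⊓ formsVanishingAt p η (m + c) =
      formsVanishingAt p ξ₁ n ⊓ formsVanishingAt p η₁ (m + c₁) := by
  have main : ∀ {ξ η ξ₁ η₁ : ℤ × ℤ} {c c₁ : ℕ}, HasMeet p ξ η n m c → HasMeet p ξ₁ η₁ n m c₁ →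
      m ≤ c → m ≤ c₁ → (p : ℤ) ^ (n - m) ∣ pairDet ξ ξ₁ →
      formsVanishingAt p ξ n ⊓ formsVanishingAt p η (m + c) ≤
        formsVanishingAt p ξ₁ n ⊓ formsVanishingAt p η₁ (m + c₁) := by
    intro ξ η ξ₁ η₁ c c₁ h h₁ hmc hmc₁ hξ
    have hle := h.le
    have hle₁ := h₁.le
    have hd : ∀ k ≤ n - m, (p : ℤ) ^ k ∣ pairDet ξ ξ₁ := fun k hk => (pow_dvd_pow _ hk).trans hξ
    have hηξ : (p : ℤ) ^ m ∣ pairDet η ξ := dvd_pairDet_comm.mp ((pow_dvd_pow _ hmc).trans h.dvd)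
    have hξη₁ : (p : ℤ) ^ c₁ ∣ pairDet ξ η₁ :=
      dvd_pairDet_trans h₁.left (hd c₁ (by omega)) h₁.dvd
    refine le_inf ((h.inf_le_iff hp h₁.left).mpr ⟨le_rfl, ?_, ?_⟩)
      ((h.inf_le_iff hp h₁.right).mpr ⟨hle₁, ?_, ?_⟩)
    · rw [show n = m + (n - m) by omega, pow_add]
      exact mul_dvd_mul_left _ (by simpa using hξ)
    · rw [show n = (n - m) + m by omega, pow_add]
      refine mul_dvd_mul (by simpa using hξ) ?_
      exact dvd_pairDet_trans h.left hηξ (hd m (by omega))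
    · rw [pow_add]
      exact mul_dvd_mul_left _ hξη₁
    · rw [mul_comm, pow_add]
      exact mul_dvd_mul (dvd_pairDet_trans h.left hηξ ((pow_dvd_pow _ hmc₁).trans hξη₁)) hξη₁
  exact le_antisymm (main h h₁ hmc hmc₁ hξ)
    (main h₁ h hmc₁ hmc (dvd_pairDet_comm.mp hξ))

lemma HasMeet.dvd_pairDet_of_inf_eq (hp : p.Prime) {ξ η ξ₁ η₁ : ℤ × ℤ} {n m c m₁ c₁ : ℕ}
    (h : HasMeet p ξ η n m c) (h₁ : HasMeet p ξ₁ η₁ n m₁ c₁)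
    (heq : formsVanishingAt p ξ n ⊓ formsVanishingAt p η (m + c) =
      formsVanishingAt p ξ₁ n ⊓ formsVanishingAt p η₁ (m₁ + c₁)) :
    (p : ℤ) ^ (n - m) ∣ pairDet ξ ξ₁ :=
  pow_dvd_of_pow_dvd_pow_mul hp ((h.inf_le_iff hp h₁.left).mp (heq.le.trans inf_le_left)).2.1

/-- If `c < b ≤ a`, the intersection depends only on `a`, `b`, `c` and on the two points modulo
`p ^ a` and `p ^ b`. -/
lemma HasMeet.inf_eq_of_lt (hp : p.Prime) {ξ η ξ₁ η₁ : ℤ × ℤ} {a b c : ℕ}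
    (h : HasMeet p ξ η (a + c) b c) (h₁ : HasMeet p ξ₁ η₁ (a + c) b c) (hcb : c < b)
    (hξ : (p : ℤ) ^ a ∣ pairDet ξ ξ₁) (hη : (p : ℤ) ^ b ∣ pairDet η η₁) :
    formsVanishingAt p ξ (a + c) ⊓ formsVanishingAt p η (b + c) =
      formsVanishingAt p ξ₁ (a + c) ⊓ formsVanishingAt p η₁ (b + c) := by
  have main : ∀ {ξ η ξ₁ η₁ : ℤ × ℤ}, HasMeet p ξ η (a + c) b c → HasMeet p ξ₁ η₁ (a + c) b c →
      (p : ℤ) ^ a ∣ pairDet ξ ξ₁ → (p : ℤ) ^ b ∣ pairDet η η₁ →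
      formsVanishingAt p ξ (a + c) ⊓ formsVanishingAt p η (b + c) ≤
        formsVanishingAt p ξ₁ (a + c) ⊓ formsVanishingAt p η₁ (b + c) := by
    intro ξ η ξ₁ η₁ h h₁ hξ hη
    have hle := h.le
    have hξc : (p : ℤ) ^ c ∣ pairDet ξ ξ₁ := (pow_dvd_pow _ (by omega)).trans hξ
    have hξη₁ : (p : ℤ) ^ c ∣ pairDet ξ η₁ := dvd_pairDet_trans h₁.left hξc h₁.dvd
    refine le_inf ((h.inf_le_iff hp h₁.left).mpr ⟨le_rfl, ?_, ?_⟩)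
      ((h.inf_le_iff hp h₁.right).mpr ⟨by omega, ?_, ?_⟩)
    · rw [add_comm, pow_add]
      exact mul_dvd_mul (pow_dvd_pow _ hcb.le) hξ
    · rw [pow_add]
      exact mul_dvd_mul hξ (dvd_pairDet_trans h.left (dvd_pairDet_comm.mp h.dvd) hξc)
    · rw [pow_add]
      exact mul_dvd_mul_left _ hξη₁
    · rw [mul_comm, pow_add]
      exact mul_dvd_mul hη hξη₁
  exact le_antisymm (main h h₁ hξ hη)
    (main h₁ h (dvd_pairDet_comm.mp hξ) (dvd_pairDet_comm.mp hη))

/-- The two kinds of intersections, those with `m ≤ c` and those with `c < m`, do not overlap. -/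
lemma HasMeet.inf_ne_inf (hp : p.Prime) {ξ η ξ₁ η₁ : ℤ × ℤ} {n m c n₁ b c₁ : ℕ}
    (h : HasMeet p ξ η n m c) (hmc : m ≤ c) (h₁ : HasMeet p ξ₁ η₁ n₁ b c₁) (hcb : c₁ < b) :
    formsVanishingAt p ξ n ⊓ formsVanishingAt p η (m + c) ≠
      formsVanishingAt p ξ₁ n₁ ⊓ formsVanishingAt p η₁ (b + c₁) := by
  intro heq
  obtain ⟨rfl, rfl⟩ := h.level_eq hp h₁ heq
  have hle := h.le
  have hex : ¬ (p : ℤ) ^ (c₁ + 1) ∣ pairDet ξ₁ η₁ := h₁.exact.resolve_left (by omega)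
  have hξ : (p : ℤ) ^ (c₁ + 1) ∣ pairDet ξ ξ₁ :=
    (pow_dvd_pow _ (by omega)).trans (h.dvd_pairDet_of_inf_eq hp h₁ heq)
  have h2 := ((h.inf_le_iff hp h₁.right).mp (heq.le.trans inf_le_right)).2.2
  have hξη₁ : ¬ (p : ℤ) ^ (c₁ + 1) ∣ pairDet ξ η₁ := fun hd =>
    hex (dvd_pairDet_trans h.left (dvd_pairDet_comm.mp hξ) hd)
  rw [mul_comm] at h2
  have h3 : (p : ℤ) ^ (c₁ + 1) ∣ pairDet η η₁ :=
    (pow_dvd_pow _ (by omega)).trans (pow_dvd_of_pow_add_dvd_mul hp h2 hξη₁)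
  exact hξη₁ (dvd_pairDet_trans h.right ((pow_dvd_pow _ (by omega)).trans h.dvd) h3)

lemma HasMeet.dvd_or_dvd_of_inf_eq (hp : p.Prime) {ξ η ξ₁ η₁ : ℤ × ℤ} {a b c l : ℕ}
    (h : HasMeet p ξ η (a + c) b c) (hcb : c < b) (h₁ : IsCoprime ξ₁.1 ξ₁.2)
    (heq : formsVanishingAt p ξ (a + c) ⊓ formsVanishingAt p η (b + c) =
      formsVanishingAt p ξ₁ (a + c) ⊓ formsVanishingAt p η₁ l) :
    (p : ℤ) ^ a ∣ pairDet ξ ξ₁ ∨ (a = b ∧ (p : ℤ) ^ a ∣ pairDet η ξ₁) := by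
  obtain ⟨-, h1, h2⟩ := (h.inf_le_iff hp h₁).mp (heq.le.trans inf_le_left)
  have hex : ¬ (p : ℤ) ^ (c + 1) ∣ pairDet ξ η := h.exact.resolve_left (by omega)
  have hle := h.le
  by_cases hξ : (p : ℤ) ^ (c + 1) ∣ pairDet ξ ξ₁
  · refine Or.inl (pow_dvd_of_pow_add_dvd_mul hp h2 fun hη => hex ?_)
    exact dvd_pairDet_trans h₁ hξ (dvd_pairDet_comm.mp hη)
  · refine Or.inr ⟨?_, pow_dvd_of_pow_add_dvd_mul hp (by rwa [mul_comm] at h2) hξ⟩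
    by_contra hab
    exact hξ ((pow_dvd_pow _ (by omega)).trans (pow_dvd_of_pow_dvd_pow_mul hp h1))

lemma HasMeet.meet_le_of_inf_eq (hp : p.Prime) {ξ η ξ₁ η₁ : ℤ × ℤ} {a b c n₁ c₁ : ℕ}
    (h : HasMeet p ξ η (a + c) b c) (hcb : c < b) (h₁ : HasMeet p ξ₁ η₁ n₁ b c₁)
    (hcb₁ : c₁ < b)
    (heq : formsVanishingAt p ξ (a + c) ⊓ formsVanishingAt p η (b + c) =
      formsVanishingAt p ξ₁ n₁ ⊓ formsVanishingAt p η₁ (b + c₁))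
    (hξ : (p : ℤ) ^ a ∣ pairDet ξ ξ₁) : c₁ ≤ c := by
  by_contra! hlt
  have hle := h.le
  have hex : ¬ (p : ℤ) ^ (c + 1) ∣ pairDet ξ η := h.exact.resolve_left (by omega)
  have hex₁ : ¬ (p : ℤ) ^ (c₁ + 1) ∣ pairDet ξ₁ η₁ := h₁.exact.resolve_left (by omega)
  obtain ⟨-, -, h2⟩ := (h.inf_le_iff hp h₁.right).mp (heq.le.trans inf_le_right)
  have hξη₁ : (p : ℤ) ^ (c + 1) ∣ pairDet ξ η₁ :=
    dvd_pairDet_trans h₁.left ((pow_dvd_pow _ (by omega)).trans hξ)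
      ((pow_dvd_pow _ (by omega)).trans h₁.dvd)
  have hηη₁ : ¬ (p : ℤ) ^ (c + 1) ∣ pairDet η η₁ := fun hd =>
    hex (dvd_pairDet_trans h₁.right hξη₁ (dvd_pairDet_comm.mp hd))
  rw [show b + c₁ = (b + c₁ - c) + c by omega] at h2
  have h3 := pow_dvd_of_pow_add_dvd_mul hp h2 hηη₁
  exact hex₁ (dvd_pairDet_trans h.left
    (dvd_pairDet_comm.mp ((pow_dvd_pow _ (by omega)).trans hξ))
    ((pow_dvd_pow _ (by omega)).trans h3))

/-- For `c < b ≤ a`, the intersection determines `a`, `b`, `c` and, up to an interchange of the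
points when `a = b`, the points modulo `p ^ a` and `p ^ b`. -/
lemma HasMeet.eq_of_inf_eq (hp : p.Prime) {ξ η ξ₁ η₁ : ℤ × ℤ} {a b c a₁ b₁ c₁ : ℕ}
    (h : HasMeet p ξ η (a + c) b c) (hcb : c < b) (h₁ : HasMeet p ξ₁ η₁ (a₁ + c₁) b₁ c₁)
    (hcb₁ : c₁ < b₁)
    (heq : formsVanishingAt p ξ (a + c) ⊓ formsVanishingAt p η (b + c) =
      formsVanishingAt p ξ₁ (a₁ + c₁) ⊓ formsVanishingAt p η₁ (b₁ + c₁)) :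
    a = a₁ ∧ b = b₁ ∧ c = c₁ ∧
      (((p : ℤ) ^ a ∣ pairDet ξ ξ₁ ∧ (p : ℤ) ^ b ∣ pairDet η η₁) ∨
        (a = b ∧ (p : ℤ) ^ a ∣ pairDet η ξ₁ ∧ (p : ℤ) ^ b ∣ pairDet ξ η₁)) := by
  have main : ∀ {ξ η : ℤ × ℤ}, HasMeet p ξ η (a + c) b c →
      formsVanishingAt p ξ (a + c) ⊓ formsVanishingAt p η (b + c) =
        formsVanishingAt p ξ₁ (a₁ + c₁) ⊓ formsVanishingAt p η₁ (b₁ + c₁) →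
      (p : ℤ) ^ a ∣ pairDet ξ ξ₁ →
      a = a₁ ∧ b = b₁ ∧ c = c₁ ∧ (p : ℤ) ^ b ∣ pairDet η η₁ := by
    intro ξ η h heq hξ
    obtain ⟨hn, rfl⟩ := h.level_eq hp h₁ heq
    have hle := h.le
    have hle₁ := h₁.le
    have hc₁ := h.meet_le_of_inf_eq hp hcb h₁ hcb₁ heq hξ
    have hc : c = c₁ := by
      refine le_antisymm ?_ hc₁
      have heq' := heq.symm
      rw [hn] at heq'
      rcases h₁.dvd_or_dvd_of_inf_eq hp hcb₁ h.left heq' with hd | ⟨hab, -⟩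
      · exact h₁.meet_le_of_inf_eq hp hcb₁ h hcb heq.symm hd
      · omega
    subst hc
    obtain rfl : a = a₁ := by omega
    refine ⟨rfl, rfl, rfl, ?_⟩
    have hex₁ : ¬ (p : ℤ) ^ (c + 1) ∣ pairDet ξ₁ η₁ := h₁.exact.resolve_left (by omega)
    obtain ⟨-, -, h2⟩ := (h.inf_le_iff hp h₁.right).mp (heq.le.trans inf_le_right)
    rw [mul_comm] at h2
    refine pow_dvd_of_pow_add_dvd_mul hp h2 fun hd => hex₁ ?_
    exact dvd_pairDet_trans h.left
      (dvd_pairDet_comm.mp ((pow_dvd_pow _ (by omega)).trans hξ)) hd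
  have hn := (h.level_eq hp h₁ heq).1
  have heq' := heq
  rw [← hn] at heq'
  rcases h.dvd_or_dvd_of_inf_eq hp hcb h₁.left heq' with hd | ⟨rfl, hd⟩
  · obtain ⟨ha, hb, hc, hη⟩ := main h heq hd
    exact ⟨ha, hb, hc, Or.inl ⟨hd, hη⟩⟩
  · obtain ⟨ha, hb, hc, hη⟩ := main h.symm_of_eq (by rwa [inf_comm]) hd
    exact ⟨ha, hb, hc, Or.inr ⟨rfl, hd, hη⟩⟩

end

/-! ### The projective line modulo a prime power -/

section
variable {p : ℕ}

/-- Representatives of the points of the projective line over `ℤ / p ^ n`, for `n ≥ 1`. -/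
noncomputable def pointReps (p n : ℕ) : Finset (ℤ × ℤ) :=
  (Finset.Ico (0 : ℤ) (p ^ n)).image (fun t => (t, 1)) ∪
    (Finset.Ico (0 : ℤ) (p ^ (n - 1))).image (fun t => (1, p * t))

lemma isCoprime_of_mem_pointReps {n : ℕ} {ξ : ℤ × ℤ} (h : ξ ∈ pointReps p n) :
    IsCoprime ξ.1 ξ.2 := by
  simp only [pointReps, Finset.mem_union, Finset.mem_image] at h
  rcases h with ⟨t, -, rfl⟩ | ⟨t, -, rfl⟩
  · exact isCoprime_one_right
  · exact isCoprime_one_left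

lemma card_filter_modEq_Ico {k n : ℕ} (hp : 0 < p) (hkn : k ≤ n) (v : ℤ) :
    ((Finset.Ico (0 : ℤ) (p ^ n)).filter (fun t => t ≡ v [ZMOD p ^ k])).card = p ^ (n - k) := by
  have hr : (0 : ℤ) < p ^ k := by positivity
  have h := Int.Ico_filter_modEq_card (0 : ℤ) (p ^ n) hr v
  have hpk : ((p : ℚ) ^ k) ≠ 0 := by positivity
  have h2 : (((p : ℤ) ^ n : ℤ) - v : ℚ) / ((p ^ k : ℤ) : ℚ) =
      ((0 : ℤ) - v : ℚ) / ((p ^ k : ℤ) : ℚ) + ((p ^ (n - k) : ℕ) : ℚ) := by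
    have : (p : ℚ) ^ n = p ^ k * p ^ (n - k) := by rw [← pow_add]; congr 1; omega
    push_cast
    rw [this]
    field_simp
    ring
  rw [h2, Int.ceil_add_natCast] at h
  have h3 : (((Finset.Ico (0 : ℤ) (p ^ n)).filter (fun t => t ≡ v [ZMOD p ^ k])).card : ℤ) =
      (p ^ (n - k) : ℕ) := by
    rw [h]
    simp
  exact_mod_cast h3

/-- A linear congruence `a ≡ b t` with `b` prime to `p` has one solution modulo `p ^ k`. -/
lemma card_filter_dvd_sub_mul (hp : p.Prime) {k n : ℕ} (hkn : k ≤ n) {a b : ℤ}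
    (hb : ¬ (p : ℤ) ∣ b) :
    ((Finset.Ico (0 : ℤ) (p ^ n)).filter (fun t => (p : ℤ) ^ k ∣ a - b * t)).card =
      p ^ (n - k) := by
  have hpp : Prime (p : ℤ) := Nat.prime_iff_prime_int.mp hp
  obtain ⟨s, u, hsu⟩ : IsCoprime (b : ℤ) ((p : ℤ) ^ k) :=
    (((Prime.coprime_iff_not_dvd hpp).mpr hb).pow_left).symm
  rw [← card_filter_modEq_Ico hp.pos hkn (a * s)]
  congr 1
  refine Finset.filter_congr fun t _ => ?_
  rw [Int.modEq_iff_dvd]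
  have hcop : IsCoprime ((p : ℤ) ^ k) b := ⟨u, s, by linarith⟩
  constructor
  · intro h
    have : a * s - t = s * (a - b * t) - p ^ k * (u * t) := by linear_combination t * hsu
    rw [this]
    exact dvd_sub (h.mul_left _) (dvd_mul_right _ _)
  · intro h
    have : a - b * t = b * (a * s - t) + p ^ k * (u * a) := by linear_combination (-a) * hsu
    rw [this]
    exact dvd_add (h.mul_left _) (dvd_mul_right _ _)

lemma card_filter_pointReps (hp : p.Prime) {n : ℕ} (P : ℤ × ℤ → Prop) [DecidablePred P] :
    ((pointReps p n).filter P).card =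
      ((Finset.Ico (0 : ℤ) (p ^ n)).filter (fun t => P (t, 1))).card +
        ((Finset.Ico (0 : ℤ) (p ^ (n - 1))).filter (fun t => P (1, p * t))).card := by
  have hp1 : ¬ (p : ℤ) ∣ 1 := by
    exact_mod_cast hp.one_lt.ne' ∘ Nat.dvd_one.mp
  rw [pointReps, Finset.filter_union, Finset.card_union_of_disjoint, Finset.filter_image,
    Finset.filter_image, Finset.card_image_of_injective, Finset.card_image_of_injective]
  · intro t t' h
    simpa [hp.ne_zero] using h
  · intro t t' h
    simpa using h
  · rw [Finset.disjoint_left]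
    intro ξ h h'
    simp only [Finset.mem_filter, Finset.mem_image] at h h'
    obtain ⟨⟨t, -, rfl⟩, -⟩ := h
    obtain ⟨⟨t', -, h⟩, -⟩ := h'
    rw [Prod.mk.injEq] at h
    exact hp1 ⟨t', h.2.symm⟩

lemma card_pointReps (hp : p.Prime) {n : ℕ} :
    (pointReps p n).card = p ^ n + p ^ (n - 1) := by
  have h := card_filter_pointReps hp (n := n) (fun _ => True)
  simp only [Finset.filter_true, Int.card_Ico, sub_zero] at h
  rw [h]
  congr 1

/-- Each point modulo `p ^ k` has `p ^ (n - k)` lifts modulo `p ^ n`. -/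
lemma card_filter_dvd_pairDet (hp : p.Prime) {n k : ℕ} (hk : 1 ≤ k) (hkn : k ≤ n) {ξ : ℤ × ℤ}
    (hξ : IsCoprime ξ.1 ξ.2) :
    ((pointReps p n).filter (fun η => (p : ℤ) ^ k ∣ pairDet ξ η)).card = p ^ (n - k) := by
  have hpp : Prime (p : ℤ) := Nat.prime_iff_prime_int.mp hp
  rw [card_filter_pointReps hp]
  simp only [pairDet, mul_one]
  have hpk : (p : ℤ) ∣ p ^ k := dvd_pow_self _ (by omega)
  by_cases hb : (p : ℤ) ∣ ξ.2
  · have ha : ¬ (p : ℤ) ∣ ξ.1 := fun ha => hpp.not_isUnit (hξ.isUnit_of_dvd' ha hb)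
    rw [Finset.filter_false_of_mem, Finset.card_empty, zero_add]
    · obtain ⟨b, hb⟩ := hb
      have := card_filter_dvd_sub_mul hp (show k - 1 ≤ n - 1 by omega) (a := b) ha
      rw [show n - 1 - (k - 1) = n - k by omega] at this
      rw [← this]
      congr 1
      refine Finset.filter_congr fun t _ => ?_
      obtain ⟨k, rfl⟩ : ∃ j, k = j + 1 := ⟨k - 1, by omega⟩
      rw [hb, show ξ.1 * (p * t) - p * b = p * (-(b - ξ.1 * t)) by ring, pow_succ',
        mul_dvd_mul_iff_left hpp.ne_zero, dvd_neg, Nat.add_sub_cancel]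
    · intro t _ h
      exact ha ((dvd_sub_left (hb.mul_right t)).mp (hpk.trans h))
  · rw [Finset.filter_false_of_mem (s := Finset.Ico (0 : ℤ) (p ^ (n - 1))), Finset.card_empty,
      add_zero]
    · exact card_filter_dvd_sub_mul hp hkn hb
    · intro t _ h
      have h1 : (p : ℤ) ∣ ξ.1 * (p * t) := ⟨ξ.1 * t, by ring⟩
      exact hb ((dvd_sub_right h1).mp (hpk.trans h))

lemma exists_mem_pointReps (hp : p.Prime) {n : ℕ} (hn : 1 ≤ n) {ξ : ℤ × ℤ}
    (hξ : IsCoprime ξ.1 ξ.2) : ∃ η ∈ pointReps p n, (p : ℤ) ^ n ∣ pairDet ξ η := by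
  have h := card_filter_dvd_pairDet hp hn le_rfl hξ
  rw [Nat.sub_self, pow_zero, Finset.card_eq_one] at h
  obtain ⟨η, hη⟩ := h
  have : η ∈ (pointReps p n).filter (fun η => (p : ℤ) ^ n ∣ pairDet ξ η) := by
    rw [hη]; exact Finset.mem_singleton_self _
  exact ⟨η, (Finset.mem_filter.mp this).1, (Finset.mem_filter.mp this).2⟩

lemma eq_of_mem_pointReps (hp : p.Prime) {n : ℕ} (hn : 1 ≤ n) {ξ η : ℤ × ℤ}
    (hξ : ξ ∈ pointReps p n) (hη : η ∈ pointReps p n) (h : (p : ℤ) ^ n ∣ pairDet ξ η) :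
    ξ = η := by
  have hc := card_filter_dvd_pairDet hp hn le_rfl (isCoprime_of_mem_pointReps hξ)
  rw [Nat.sub_self, pow_zero, Finset.card_eq_one] at hc
  obtain ⟨ζ, hζ⟩ := hc
  have h1 : ξ ∈ (pointReps p n).filter (fun η => (p : ℤ) ^ n ∣ pairDet ξ η) :=
    Finset.mem_filter.mpr ⟨hξ, by rw [pairDet_self]; exact dvd_zero _⟩
  have h2 : η ∈ (pointReps p n).filter (fun η => (p : ℤ) ^ n ∣ pairDet ξ η) :=
    Finset.mem_filter.mpr ⟨hη, h⟩
  rw [hζ, Finset.mem_singleton] at h1 h2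
  rw [h1, h2]

/-- Pairs of points modulo `p ^ a` and `p ^ b` that agree exactly modulo `p ^ c`. -/
noncomputable def meetingPairs (p a b c : ℕ) : Finset ((ℤ × ℤ) × (ℤ × ℤ)) :=
  (pointReps p a ×ˢ pointReps p b).filter
    (fun x => (p : ℤ) ^ c ∣ pairDet x.1 x.2 ∧ ¬ (p : ℤ) ^ (c + 1) ∣ pairDet x.1 x.2)

lemma card_meetingPairs (hp : p.Prime) {a b c : ℕ} (ha : c < a) (hb : c < b) :
    ((meetingPairs p a b c).card : ℤ) =
      if c = 0 then ((p : ℤ) + 1) * p ^ (a + b - 1)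
      else ((p : ℤ) ^ 2 - 1) * p ^ (a + b - c - 2) := by
  have hfib : ∀ ξ ∈ pointReps p a, (((pointReps p b).filter (fun η => (p : ℤ) ^ c ∣ pairDet ξ η ∧
      ¬ (p : ℤ) ^ (c + 1) ∣ pairDet ξ η)).card : ℤ) =
      if c = 0 then (p : ℤ) ^ b else (p - 1) * (p : ℤ) ^ (b - c - 1) := by
    intro ξ hξ
    have hcop := isCoprime_of_mem_pointReps hξ
    have h1 := card_filter_dvd_pairDet hp (by omega : 1 ≤ c + 1) (by omega : c + 1 ≤ b) hcop
    have h2 := Finset.card_filter_add_card_filter_not (s := (pointReps p b).filter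
      (fun η => (p : ℤ) ^ c ∣ pairDet ξ η)) (fun η => (p : ℤ) ^ (c + 1) ∣ pairDet ξ η)
    rw [Finset.filter_filter, Finset.filter_filter] at h2
    have h3 : (pointReps p b).filter (fun η => (p : ℤ) ^ c ∣ pairDet ξ η ∧
        (p : ℤ) ^ (c + 1) ∣ pairDet ξ η) =
        (pointReps p b).filter (fun η => (p : ℤ) ^ (c + 1) ∣ pairDet ξ η) :=
      Finset.filter_congr fun η _ =>
        ⟨fun h => h.2, fun h => ⟨(pow_dvd_pow _ (Nat.le_succ c)).trans h, h⟩⟩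
    rw [h3, h1] at h2
    split_ifs with hc
    · subst hc
      simp only [pow_zero, one_dvd, Finset.filter_true, true_and, card_pointReps hp] at h2 ⊢
      have : (_ : ℤ) = _ := congrArg (Nat.cast : ℕ → ℤ) h2
      push_cast at this
      simp only [zero_add] at this ⊢
      linarith
    · rw [card_filter_dvd_pairDet hp (by omega) hb.le hcop] at h2
      obtain ⟨e, rfl⟩ : ∃ e, b = c + 1 + e := ⟨b - c - 1, by omega⟩
      rw [show c + 1 + e - c = e + 1 by omega, show c + 1 + e - (c + 1) = e by omega] at h2
      rw [show c + 1 + e - c - 1 = e by omega]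
      have h4 : (_ : ℤ) = _ := congrArg (Nat.cast : ℕ → ℤ) h2
      rw [Nat.cast_add, Nat.cast_pow, Nat.cast_pow, pow_succ (p : ℤ) e] at h4
      linarith
  have hsum : (meetingPairs p a b c).card = ∑ ξ ∈ pointReps p a, ((pointReps p b).filter
      (fun η => (p : ℤ) ^ c ∣ pairDet ξ η ∧ ¬ (p : ℤ) ^ (c + 1) ∣ pairDet ξ η)).card := by
    simp only [meetingPairs, Finset.card_filter]
    rw [Finset.sum_product]
  rw [hsum, Nat.cast_sum, Finset.sum_congr rfl hfib, Finset.sum_const, card_pointReps hp,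
    nsmul_eq_mul]
  obtain ⟨e, rfl⟩ : ∃ e, a = e + 1 := ⟨a - 1, by omega⟩
  obtain ⟨f, rfl⟩ : ∃ f, b = c + 1 + f := ⟨b - c - 1, by omega⟩
  split_ifs with hc
  · subst hc
    rw [show e + 1 + (0 + 1 + f) - 1 = e + (f + 1) by omega, show e + 1 - 1 = e by omega]
    push_cast
    ring
  · rw [show e + 1 + (c + 1 + f) - c - 2 = e + f by omega, show e + 1 - 1 = e by omega,
      show c + 1 + f - c - 1 = f by omega]
    push_cast
    ring

end

/-! ### Counting intersections of two groups of forms -/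

section
variable {p : ℕ}

/-- The subgroups of index `p ^ r` among the intersections of two groups `formsVanishingAt`. -/
def formIntersections (p r : ℕ) : Set (AddSubgroup (ℤ × ℤ × ℤ)) :=
  {G | G.index = p ^ r ∧ ∃ ξ η : ℤ × ℤ, ∃ n l : ℕ, IsCoprime ξ.1 ξ.2 ∧ IsCoprime η.1 η.2 ∧
    G = formsVanishingAt p ξ n ⊓ formsVanishingAt p η l}

/-- A second point that makes `HasMeet p ξ · n m m` hold. -/
lemma exists_hasMeet (hp : p.Prime) {ξ : ℤ × ℤ} (hξ : IsCoprime ξ.1 ξ.2) (m : ℕ) :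
    ∃ η, ∀ n, m + m ≤ n → HasMeet p ξ η n m m := by
  obtain ⟨ξ', h⟩ := exists_pairDet_eq_one hξ
  have hpp : Prime (p : ℤ) := Nat.prime_iff_prime_int.mp hp
  refine ⟨(ξ.1 + p ^ m * ξ'.1, ξ.2 + p ^ m * ξ'.2), fun n hn => ?_⟩
  have hdet : pairDet ξ (ξ.1 + p ^ m * ξ'.1, ξ.2 + p ^ m * ξ'.2) = p ^ m := by
    have : pairDet ξ (ξ.1 + p ^ m * ξ'.1, ξ.2 + p ^ m * ξ'.2) = p ^ m * pairDet ξ ξ' := by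
      simp only [pairDet]; ring
    rw [this, h, mul_one]
  have hdet' : pairDet (ξ.1 + p ^ m * ξ'.1, ξ.2 + p ^ m * ξ'.2) ξ' = 1 := by
    rw [← h]; simp only [pairDet]; ring
  refine ⟨hξ, isCoprime_of_pairDet_eq_one hdet', hn, by rw [hdet], Or.inr ?_⟩
  rw [hdet, pow_dvd_pow_iff hpp.ne_zero hpp.not_isUnit]
  omega

/-- Any two points of levels `l ≤ n` are in the position described by `HasMeet`. -/
lemma exists_hasMeet_of_le {ξ η : ℤ × ℤ} (hξ : IsCoprime ξ.1 ξ.2)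
    (hη : IsCoprime η.1 η.2) {n l : ℕ} (hl : l ≤ n) :
    ∃ m c, m + c = l ∧ HasMeet p ξ η n m c := by
  classical
  by_cases h : (p : ℤ) ^ l ∣ pairDet ξ η
  · exact ⟨0, l, zero_add l, hξ, hη, by omega, h, Or.inl rfl⟩
  · have hex : ∃ k, ¬ (p : ℤ) ^ k ∣ pairDet ξ η := ⟨l, h⟩
    have hk0 : Nat.find hex ≠ 0 := by
      intro h0
      have := Nat.find_spec hex
      rw [h0] at this
      simp at this
    have hle : Nat.find hex ≤ l := Nat.find_min' hex h
    refine ⟨l - (Nat.find hex - 1), Nat.find hex - 1, by omega, hξ, hη, by omega, ?_, Or.inr ?_⟩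
    · exact not_not.mp (Nat.find_min hex (by omega : Nat.find hex - 1 < Nat.find hex))
    · rw [Nat.sub_add_cancel (by omega)]
      exact Nat.find_spec hex

/-- Index set for the intersections with `c < a` and `c < b`, where `a + b + c = r`: the entries are
`c`, `a`, and a pair of points modulo `p ^ a` and `p ^ b` that agree exactly modulo `p ^ c`. -/
noncomputable def tripodIndex (p r : ℕ) : Finset (Σ _ : ℕ, Σ _ : ℕ, (ℤ × ℤ) × (ℤ × ℤ)) :=
  (Finset.range r).sigma fun c => (Finset.Ioo c (r - 2 * c)).sigma fun a =>
    meetingPairs p a (r - a - c) c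

/-- The intersection belonging to an element of `tripodIndex`. -/
def tripodForms (p r : ℕ) (d : Σ _ : ℕ, Σ _ : ℕ, (ℤ × ℤ) × (ℤ × ℤ)) :
    AddSubgroup (ℤ × ℤ × ℤ) :=
  formsVanishingAt p d.2.2.1 (d.2.1 + d.1) ⊓
    formsVanishingAt p d.2.2.2 (r - d.2.1 - d.1 + d.1)

/-- The interchange of the two points. -/
def tripodSwap (r : ℕ) (d : Σ _ : ℕ, Σ _ : ℕ, (ℤ × ℤ) × (ℤ × ℤ)) :
    Σ _ : ℕ, Σ _ : ℕ, (ℤ × ℤ) × (ℤ × ℤ) :=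
  ⟨d.1, r - d.2.1 - d.1, d.2.2.swap⟩

/-- Index set for the intersections with `m ≤ c`: the entries are `m` and a point modulo
`p ^ (r - 2 m)`. -/
noncomputable def stemIndex (p r : ℕ) : Finset (Σ _ : ℕ, ℤ × ℤ) :=
  (Finset.range (r / 3 + 1)).sigma fun m => pointReps p (r - 2 * m)

lemma mem_tripodIndex {r c a : ℕ} {ξ η : ℤ × ℤ} :
    (⟨c, a, ξ, η⟩ : Σ _ : ℕ, Σ _ : ℕ, (ℤ × ℤ) × (ℤ × ℤ)) ∈ tripodIndex p r ↔
      (c < a ∧ a + 2 * c < r) ∧ (ξ ∈ pointReps p a ∧ η ∈ pointReps p (r - a - c)) ∧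
        (p : ℤ) ^ c ∣ pairDet ξ η ∧ ¬ (p : ℤ) ^ (c + 1) ∣ pairDet ξ η := by
  simp only [tripodIndex, meetingPairs, Finset.mem_sigma, Finset.mem_range, Finset.mem_Ioo,
    Finset.mem_filter, Finset.mem_product]
  constructor
  · rintro ⟨h1, ⟨h2, h3⟩, h4⟩
    exact ⟨⟨h2, by omega⟩, h4⟩
  · rintro ⟨⟨h1, h2⟩, h4⟩
    exact ⟨by omega, ⟨h1, by omega⟩, h4⟩

lemma tripodSwap_mem {r : ℕ} {d : Σ _ : ℕ, Σ _ : ℕ, (ℤ × ℤ) × (ℤ × ℤ)}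
    (h : d ∈ tripodIndex p r) : tripodSwap r d ∈ tripodIndex p r := by
  obtain ⟨c, a, ξ, η⟩ := d
  simp only [tripodSwap, Prod.swap]
  rw [mem_tripodIndex] at h ⊢
  obtain ⟨h1, ⟨h2, h3⟩, h4, h5⟩ := h
  refine ⟨by omega, ⟨h3, ?_⟩, dvd_pairDet_comm.mp h4, fun h => h5 (dvd_pairDet_comm.mp h)⟩
  rwa [show r - (r - a - c) - c = a by omega]

lemma tripodSwap_tripodSwap {r : ℕ} {d : Σ _ : ℕ, Σ _ : ℕ, (ℤ × ℤ) × (ℤ × ℤ)}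
    (h : d ∈ tripodIndex p r) : tripodSwap r (tripodSwap r d) = d := by
  obtain ⟨c, a, ξ, η⟩ := d
  rw [mem_tripodIndex] at h
  simp only [tripodSwap, Prod.swap]
  rw [show r - (r - a - c) - c = a by omega]

lemma tripodForms_tripodSwap {r : ℕ} {d : Σ _ : ℕ, Σ _ : ℕ, (ℤ × ℤ) × (ℤ × ℤ)}
    (h : d ∈ tripodIndex p r) : tripodForms p r (tripodSwap r d) = tripodForms p r d := by
  obtain ⟨c, a, ξ, η⟩ := d
  rw [mem_tripodIndex] at h
  simp only [tripodSwap, Prod.swap, tripodForms]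
  rw [show r - (r - a - c) - c = a by omega, inf_comm]

lemma tripodSwap_ne {r : ℕ} {d : Σ _ : ℕ, Σ _ : ℕ, (ℤ × ℤ) × (ℤ × ℤ)}
    (h : d ∈ tripodIndex p r) : tripodSwap r d ≠ d := by
  obtain ⟨c, a, ξ, η⟩ := d
  rw [mem_tripodIndex] at h
  intro heq
  simp only [tripodSwap, Prod.swap, Sigma.mk.injEq, heq_eq_eq, Prod.mk.injEq, true_and] at heq
  obtain ⟨-, rfl, -⟩ := heq
  exact h.2.2.2 (by rw [pairDet_self]; exact dvd_zero _)

lemma hasMeet_of_mem_tripodIndex {r c a : ℕ} {ξ η : ℤ × ℤ}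
    (h : (⟨c, a, ξ, η⟩ : Σ _ : ℕ, Σ _ : ℕ, (ℤ × ℤ) × (ℤ × ℤ)) ∈ tripodIndex p r)
    (hab : r - a - c ≤ a) : HasMeet p ξ η (a + c) (r - a - c) c := by
  rw [mem_tripodIndex] at h
  exact ⟨isCoprime_of_mem_pointReps h.2.1.1, isCoprime_of_mem_pointReps h.2.1.2, by omega,
    h.2.2.1, Or.inr h.2.2.2⟩

lemma eq_or_eq_tripodSwap (hp : p.Prime) {r : ℕ}
    {d d' : Σ _ : ℕ, Σ _ : ℕ, (ℤ × ℤ) × (ℤ × ℤ)} (h : d ∈ tripodIndex p r)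
    (h' : d' ∈ tripodIndex p r) (heq : tripodForms p r d = tripodForms p r d') :
    d' = d ∨ d' = tripodSwap r d := by
  have main : ∀ {d d' : Σ _ : ℕ, Σ _ : ℕ, (ℤ × ℤ) × (ℤ × ℤ)}, d ∈ tripodIndex p r →
      d' ∈ tripodIndex p r → tripodForms p r d = tripodForms p r d' →
      r - d.2.1 - d.1 ≤ d.2.1 → r - d'.2.1 - d'.1 ≤ d'.2.1 → d' = d ∨ d' = tripodSwap r d := by
    rintro ⟨c, a, ξ, η⟩ ⟨c', a', ξ', η'⟩ h h' heq hd hd'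
    simp only at hd hd'
    have hm := hasMeet_of_mem_tripodIndex h hd
    have hm' := hasMeet_of_mem_tripodIndex h' hd'
    rw [mem_tripodIndex] at h h'
    obtain ⟨rfl, -, rfl, hcase⟩ := hm.eq_of_inf_eq hp (by omega) hm' (by omega) heq
    rcases hcase with ⟨h1, h2⟩ | ⟨hab, h1, h2⟩
    · left
      rw [eq_of_mem_pointReps hp (by omega) h.2.1.1 h'.2.1.1 h1,
        eq_of_mem_pointReps hp (by omega) h.2.1.2 h'.2.1.2 h2]
    · right
      rw [← hab] at h2 h h'
      simp only [tripodSwap, Prod.swap]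
      rw [eq_of_mem_pointReps hp (by omega) h.2.1.2 h'.2.1.1 h1,
        eq_of_mem_pointReps hp (by omega) h.2.1.1 h'.2.1.2 h2, ← hab]
  -- after interchanging points, the first point has the larger level
  have hswap : ∀ {d : Σ _ : ℕ, Σ _ : ℕ, (ℤ × ℤ) × (ℤ × ℤ)}, d ∈ tripodIndex p r →
      r - d.2.1 - d.1 ≤ d.2.1 ∨
        r - (tripodSwap r d).2.1 - (tripodSwap r d).1 ≤ (tripodSwap r d).2.1 := by
    rintro ⟨c, a, ξ, η⟩ h
    rw [mem_tripodIndex] at h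
    simp only [tripodSwap]
    omega
  have hs := tripodSwap_mem h
  have hs' := tripodSwap_mem h'
  have hf := tripodForms_tripodSwap h
  have hf' := tripodForms_tripodSwap h'
  have hss := tripodSwap_tripodSwap h
  have hss' := tripodSwap_tripodSwap h'
  rcases hswap h with hd | hd <;> rcases hswap h' with hd' | hd'
  · exact main h h' heq hd hd'
  · rcases main h hs' (heq.trans hf'.symm) hd hd' with h1 | h1
    · right; rw [← h1, hss']
    · left; rw [← hss', h1, hss]
  · rcases main hs h' (hf.trans heq) hd hd' with h1 | h1
    · exact Or.inr h1
    · left; rw [h1, hss]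
  · rcases main hs hs' (hf.trans (heq.trans hf'.symm)) hd hd' with h1 | h1
    · left; rw [← hss', h1, hss]
    · right; rw [← hss', h1, hss]

lemma card_image_tripodForms (hp : p.Prime) (r : ℕ) [DecidableEq (AddSubgroup (ℤ × ℤ × ℤ))] :
    2 * ((tripodIndex p r).image (tripodForms p r)).card = (tripodIndex p r).card := by
  rw [Finset.card_eq_sum_card_image (tripodForms p r) (tripodIndex p r),
    Finset.sum_const_nat (m := 2), mul_comm]
  intro G hG
  obtain ⟨d, hd, rfl⟩ := Finset.mem_image.mp hG
  rw [Finset.card_eq_two]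
  refine ⟨d, tripodSwap r d, (tripodSwap_ne hd).symm, ?_⟩
  ext d'
  simp only [Finset.mem_filter, Finset.mem_insert, Finset.mem_singleton]
  constructor
  · rintro ⟨h1, h2⟩
    exact eq_or_eq_tripodSwap hp hd h1 h2.symm
  · rintro (rfl | rfl)
    · exact ⟨hd, rfl⟩
    · exact ⟨tripodSwap_mem hd, tripodForms_tripodSwap hd⟩

lemma card_tripodIndex (hp : p.Prime) (r : ℕ) :
    ((tripodIndex p r).card : ℤ) = ∑ c ∈ Finset.range r, ((r - 3 * c - 1 : ℕ) : ℤ) *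
      (if c = 0 then ((p : ℤ) + 1) * p ^ (r - 1) else ((p : ℤ) ^ 2 - 1) * p ^ (r - 2 * c - 2)) := by
  rw [tripodIndex, Finset.card_sigma, Nat.cast_sum]
  refine Finset.sum_congr rfl fun c _ => ?_
  rw [Finset.card_sigma, Nat.cast_sum]
  have hconst : ∀ a ∈ Finset.Ioo c (r - 2 * c),
      ((meetingPairs p a (r - a - c) c).card : ℤ) =
        if c = 0 then ((p : ℤ) + 1) * p ^ (r - 1)
        else ((p : ℤ) ^ 2 - 1) * p ^ (r - 2 * c - 2) := by
    intro a ha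
    rw [Finset.mem_Ioo] at ha
    rw [card_meetingPairs hp ha.1 (by omega)]
    split_ifs with hc
    · rw [show a + (r - a - c) - 1 = r - 1 by omega]
    · rw [show a + (r - a - c) - c - 2 = r - 2 * c - 2 by omega]
  rw [Finset.sum_congr rfl hconst, Finset.sum_const, Nat.card_Ioo, nsmul_eq_mul,
    show r - 2 * c - c - 1 = r - 3 * c - 1 by omega]

lemma card_stemIndex (hp : p.Prime) {r : ℕ} (hr : 1 ≤ r) :
    ((stemIndex p r).card : ℤ) =
      ∑ m ∈ Finset.range (r / 3 + 1), ((p : ℤ) + 1) * p ^ (r - 2 * m - 1) := by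
  rw [stemIndex, Finset.card_sigma, Nat.cast_sum]
  refine Finset.sum_congr rfl fun m hm => ?_
  rw [Finset.mem_range] at hm
  rw [card_pointReps hp, show r - 2 * m = r - 2 * m - 1 + 1 by omega]
  rw [Nat.add_sub_cancel]
  push_cast
  ring

/-- The number of intersections of index `p ^ r`, doubled to avoid fractions. -/
theorem formIntersections_card (hp : p.Prime) {r : ℕ} (hr : 1 ≤ r) :
    (formIntersections p r).Finite ∧ 2 * ((formIntersections p r).ncard : ℤ) =
      2 * ∑ m ∈ Finset.range (r / 3 + 1), ((p : ℤ) + 1) * p ^ (r - 2 * m - 1) +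
      ∑ c ∈ Finset.range r, ((r - 3 * c - 1 : ℕ) : ℤ) *
        (if c = 0 then ((p : ℤ) + 1) * p ^ (r - 1)
        else ((p : ℤ) ^ 2 - 1) * p ^ (r - 2 * c - 2)) := by
  classical
  have hchoice : ∀ ξ : ℤ × ℤ, ∀ m : ℕ, ∃ η, IsCoprime ξ.1 ξ.2 →
      ∀ n, m + m ≤ n → HasMeet p ξ η n m m := by
    intro ξ m
    by_cases hξ : IsCoprime ξ.1 ξ.2
    · obtain ⟨η, hη⟩ := exists_hasMeet hp hξ m
      exact ⟨η, fun _ => hη⟩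
    · exact ⟨ξ, fun h => absurd h hξ⟩
  choose mate hmate using hchoice
  let stemForms : (Σ _ : ℕ, ℤ × ℤ) → AddSubgroup (ℤ × ℤ × ℤ) := fun d =>
    formsVanishingAt p d.2 (r - d.1) ⊓ formsVanishingAt p (mate d.2 d.1) (d.1 + d.1)
  have hstem : ∀ {m : ℕ} {ξ : ℤ × ℤ}, (⟨m, ξ⟩ : Σ _ : ℕ, ℤ × ℤ) ∈ stemIndex p r →
      3 * m ≤ r ∧ ξ ∈ pointReps p (r - 2 * m) ∧ HasMeet p ξ (mate ξ m) (r - m) m m := by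
    intro m ξ h
    simp only [stemIndex, Finset.mem_sigma, Finset.mem_range] at h
    exact ⟨by omega, h.2, hmate ξ m (isCoprime_of_mem_pointReps h.2) _ (by omega)⟩
  have hinj : Set.InjOn stemForms (stemIndex p r : Set (Σ _ : ℕ, ℤ × ℤ)) := by
    rintro ⟨m, ξ⟩ h ⟨m', ξ'⟩ h' heq
    obtain ⟨hm, hξ, hmeet⟩ := hstem h
    obtain ⟨hm', hξ', hmeet'⟩ := hstem h'
    obtain ⟨-, rfl⟩ := hmeet.level_eq hp hmeet' heq
    have hd := hmeet.dvd_pairDet_of_inf_eq hp hmeet' heq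
    rw [show r - m - m = r - 2 * m by omega] at hd
    rw [eq_of_mem_pointReps hp (by omega) hξ hξ' hd]
  have hdisj : Disjoint ((stemIndex p r).image stemForms)
      ((tripodIndex p r).image (tripodForms p r)) := by
    rw [Finset.disjoint_left]
    intro G h h'
    obtain ⟨⟨m, ξ⟩, hd, rfl⟩ := Finset.mem_image.mp h
    obtain ⟨d, hd', heq⟩ := Finset.mem_image.mp h'
    obtain ⟨-, -, hmeet⟩ := hstem hd
    have key : ∀ d ∈ tripodIndex p r, r - d.2.1 - d.1 ≤ d.2.1 →
        tripodForms p r d ≠ stemForms ⟨m, ξ⟩ := by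
      rintro ⟨c, a, ξ₁, η₁⟩ h1 h2
      have hm := hasMeet_of_mem_tripodIndex h1 h2
      rw [mem_tripodIndex] at h1
      exact (hmeet.inf_ne_inf hp le_rfl hm (by omega)).symm
    by_cases hle : r - d.2.1 - d.1 ≤ d.2.1
    · exact key d hd' hle heq
    · refine key _ (tripodSwap_mem hd') ?_ ((tripodForms_tripodSwap hd').trans heq)
      obtain ⟨c, a, ξ₁, η₁⟩ := d
      simp only [tripodSwap] at hle ⊢
      omega
  have hset : formIntersections p r =
      ((stemIndex p r).image stemForms ∪ (tripodIndex p r).image (tripodForms p r) :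
        Finset (AddSubgroup (ℤ × ℤ × ℤ))) := by
    ext G
    simp only [Finset.coe_union, Finset.coe_image, Set.mem_union, Set.mem_image, Finset.mem_coe]
    constructor
    · rintro ⟨hidx, ξ, η, n, l, hξ, hη, hG⟩
      have main : ∀ {ξ η : ℤ × ℤ} {n l : ℕ}, IsCoprime ξ.1 ξ.2 → IsCoprime η.1 η.2 → l ≤ n →
          G = formsVanishingAt p ξ n ⊓ formsVanishingAt p η l →
          (∃ d ∈ stemIndex p r, stemForms d = G) ∨
            ∃ d ∈ tripodIndex p r, tripodForms p r d = G := by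
        rintro ξ η n l hξ hη hl rfl
        obtain ⟨m, c, rfl, hmeet⟩ := exists_hasMeet_of_le (p := p) hξ hη hl
        have hr' : n + m = r := by
          rw [hmeet.index_inf hp] at hidx
          exact Nat.pow_right_injective hp.two_le hidx
        by_cases hmc : m ≤ c
        · left
          obtain ⟨ζ, hζ, hd⟩ := exists_mem_pointReps hp (by omega : 1 ≤ r - 2 * m) hξ
          have hmem : (⟨m, ζ⟩ : Σ _ : ℕ, ℤ × ℤ) ∈ stemIndex p r := by
            simp only [stemIndex, Finset.mem_sigma, Finset.mem_range]
            exact ⟨by omega, hζ⟩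
          refine ⟨_, hmem, ?_⟩
          obtain ⟨-, -, hmeet'⟩ := hstem hmem
          obtain rfl : n = r - m := by omega
          refine hmeet'.inf_eq_of_le hp hmeet le_rfl hmc ?_
          rw [show r - m - m = r - 2 * m by omega]
          exact dvd_pairDet_comm.mp hd
        · right
          have hlt : c < m := by omega
          obtain ⟨a, rfl⟩ : ∃ a, n = a + c := ⟨n - c, by omega⟩
          obtain rfl : m = r - a - c := by omega
          obtain ⟨ξ₁, hξ₁, hd⟩ := exists_mem_pointReps hp (by omega : 1 ≤ a) hξ
          obtain ⟨η₁, hη₁, hd'⟩ := exists_mem_pointReps hp (by omega : 1 ≤ r - a - c) hη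
          have hex := hmeet.exact.resolve_left (by omega)
          have hξ₁' := isCoprime_of_mem_pointReps hξ₁
          have hη₁' := isCoprime_of_mem_pointReps hη₁
          have hca : c + 1 ≤ a := by omega
          have hdvd : (p : ℤ) ^ c ∣ pairDet ξ₁ η₁ :=
            dvd_pairDet_trans hξ (dvd_pairDet_comm.mp ((pow_dvd_pow _ (by omega)).trans hd))
              (dvd_pairDet_trans hη hmeet.dvd ((pow_dvd_pow _ (by omega)).trans hd'))
          have hndvd : ¬ (p : ℤ) ^ (c + 1) ∣ pairDet ξ₁ η₁ := fun h => hex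
            (dvd_pairDet_trans hξ₁' ((pow_dvd_pow _ hca).trans hd)
              (dvd_pairDet_trans hη₁' h
                (dvd_pairDet_comm.mp ((pow_dvd_pow _ (by omega)).trans hd'))))
          have hle := hmeet.le
          have hmem : (⟨c, a, ξ₁, η₁⟩ : Σ _ : ℕ, Σ _ : ℕ, (ℤ × ℤ) × (ℤ × ℤ)) ∈
              tripodIndex p r :=
            mem_tripodIndex.mpr ⟨by omega, ⟨hξ₁, hη₁⟩, hdvd, hndvd⟩
          refine ⟨_, hmem, ?_⟩
          exact (hasMeet_of_mem_tripodIndex hmem (by omega)).inf_eq_of_lt hp hmeet hlt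
            (dvd_pairDet_comm.mp hd) (dvd_pairDet_comm.mp hd')
      rcases le_total l n with hl | hl
      · exact main hξ hη hl hG
      · exact main hη hξ hl (by rw [hG, inf_comm])
    · rintro (⟨⟨m, ξ⟩, hd, rfl⟩ | ⟨d, hd, rfl⟩)
      · obtain ⟨hm, -, hmeet⟩ := hstem hd
        refine ⟨?_, _, _, _, _, hmeet.left, hmeet.right, rfl⟩
        rw [hmeet.index_inf hp]
        congr 1
        omega
      · have key : ∀ d ∈ tripodIndex p r, r - d.2.1 - d.1 ≤ d.2.1 →
            tripodForms p r d ∈ formIntersections p r := by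
          rintro ⟨c, a, ξ, η⟩ h1 h2
          have hm := hasMeet_of_mem_tripodIndex h1 h2
          refine ⟨?_, _, _, _, _, hm.left, hm.right, rfl⟩
          rw [tripodForms, hm.index_inf hp]
          rw [mem_tripodIndex] at h1
          congr 1
          omega
        by_cases hle : r - d.2.1 - d.1 ≤ d.2.1
        · exact key d hd hle
        · rw [← tripodForms_tripodSwap hd]
          refine key _ (tripodSwap_mem hd) ?_
          obtain ⟨c, a, ξ₁, η₁⟩ := d
          simp only [tripodSwap] at hle ⊢
          omega
  rw [hset]
  refine ⟨Finset.finite_toSet _, ?_⟩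
  rw [Set.ncard_coe_finset, Finset.card_union_of_disjoint hdisj, Finset.card_image_of_injOn hinj,
    ← card_stemIndex hp hr, ← card_tripodIndex hp, ← card_image_tripodForms hp]
  push_cast
  ring

end

/-! ### The cubic lattice as a lattice of binary quadratic forms -/

section
variable {p : ℕ}

lemma not_dvd_two (hodd : Odd p) (hp : p.Prime) : ¬ (p : ℤ) ∣ 2 := by
  intro h
  have := (Nat.prime_dvd_prime_iff_eq hp Nat.prime_two).mp (by exact_mod_cast h)
  rw [this] at hodd
  exact absurd hodd (by decide)

/-- By Hensel lifting, `-1` is a sum of two squares modulo every power of an odd prime. -/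
lemma exists_sq_add_sq_add_one (hp : p.Prime) (hodd : Odd p) (N : ℕ) :
    ∃ s t : ℤ, (p : ℤ) ^ (N + 1) ∣ s ^ 2 + t ^ 2 + 1 ∧ ¬ (p : ℤ) ∣ s := by
  have hpp : Prime (p : ℤ) := Nat.prime_iff_prime_int.mp hp
  have := Fact.mk hp
  have h2 := not_dvd_two hodd hp
  induction N with
  | zero =>
    obtain ⟨a, b, hab⟩ := ZMod.sq_add_sq p (-1)
    obtain ⟨s, rfl⟩ := ZMod.intCast_surjective a
    obtain ⟨t, rfl⟩ := ZMod.intCast_surjective b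
    have h : (p : ℤ) ∣ s ^ 2 + t ^ 2 + 1 := by
      rw [← ZMod.intCast_zmod_eq_zero_iff_dvd]
      push_cast
      rw [hab]
      ring
    by_cases hs : (p : ℤ) ∣ s
    · refine ⟨t, s, by rw [zero_add, pow_one, add_comm (t ^ 2)]; exact h, fun ht => ?_⟩
      have h1 : (p : ℤ) ∣ s ^ 2 + t ^ 2 :=
        dvd_add (dvd_pow hs two_ne_zero) (dvd_pow ht two_ne_zero)
      exact hpp.not_dvd_one ((dvd_add_right h1).mp h)
    · exact ⟨s, t, by simpa using h, hs⟩
  | succ N ih =>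
    obtain ⟨s, t, ⟨q, hq⟩, hs⟩ := ih
    have hcop : IsCoprime (p : ℤ) (2 * s) := (Prime.coprime_iff_not_dvd hpp).mpr fun h =>
      (hpp.dvd_or_dvd h).elim h2 hs
    obtain ⟨u, w, huw⟩ := hcop
    refine ⟨s + p ^ (N + 1) * (-(w * q)), t, ⟨u * q + p ^ N * (w * q) ^ 2, ?_⟩, fun h => hs ?_⟩
    · linear_combination hq + (-(p : ℤ) ^ (N + 1) * q) * huw
    · exact (dvd_add_left ((dvd_pow_self _ (Nat.succ_ne_zero N)).mul_right _)).mp h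

/-- `Φ` identifies `ℤ³`, modulo `p ^ N`, with the binary quadratic forms, in such a way that four
times the dot product becomes minus the polarized discriminant. -/
structure IsFormIsometry (p N : ℕ) (Φ : (Fin 3 → ℤ) →+ ℤ × ℤ × ℤ) : Prop where
  surj : ∀ v, ∃ y w, Φ y = v + (p ^ N : ℕ) • w
  dot : ∀ y y', (p : ℤ) ^ N ∣ 4 * (y ⬝ᵥ y') -
    (2 * (Φ y).1 * (Φ y').2.2 + 2 * (Φ y).2.2 * (Φ y').1 - (Φ y).2.1 * (Φ y').2.1)

theorem exists_isFormIsometry (hp : p.Prime) (hodd : Odd p) (N : ℕ) :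
    ∃ Φ, IsFormIsometry p N Φ := by
  obtain ⟨s, t, hst, -⟩ := exists_sq_add_sq_add_one hp hodd N
  replace hst : (p : ℤ) ^ N ∣ s ^ 2 + t ^ 2 + 1 := (pow_dvd_pow _ (Nat.le_succ N)).trans hst
  obtain ⟨q, hq⟩ := hst
  obtain ⟨h, hh⟩ : ∃ h : ℤ, 2 * h = p ^ N + 1 := by
    have : Odd ((p : ℤ) ^ N) := by exact_mod_cast hodd.pow
    obtain ⟨k, hk⟩ := this
    exact ⟨k + 1, by rw [hk]; ring⟩
  -- the coefficients of the form are `y · e`, `2 y · h`, `y · f` for the hyperbolic pair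
  -- `e = (1, s, t)`, `f = (1, -s, -t)` and `h = (0, t, -s)`, which is orthogonal to `e` and `f`
  refine ⟨AddMonoidHom.mk' (fun y => (y 0 + s * y 1 + t * y 2, 2 * (t * y 1 - s * y 2),
    y 0 - s * y 1 - t * y 2)) ?_, ?_, ?_⟩
  · intro y y'
    ext <;> simp <;> ring
  · rintro ⟨a, b, c⟩
    refine ⟨![h * (a + c), -(h * (s * (a - c) + t * b)), -(h * (t * (a - c) - s * b))],
      (a - q * h * (a - c), b - 2 * q * h * b, c + q * h * (a - c)), ?_⟩
    ext
    · simp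
      linear_combination a * hh - h * (a - c) * hq
    · simp
      linear_combination b * hh - 2 * h * b * hq
    · simp
      linear_combination c * hh + h * (a - c) * hq
  · intro y y'
    simp only [AddMonoidHom.mk'_apply, dotProduct, Fin.sum_univ_three]
    refine ⟨4 * (q * (y 1 * y' 1 + y 2 * y' 2)), ?_⟩
    linear_combination (4 * (y 1 * y' 1 + y 2 * y' 2)) * hq

lemma exists_dvd_add_mul (hp : p.Prime) (n : ℕ) (a : ℤ) {b : ℤ} (hb : ¬ (p : ℤ) ∣ b) :
    ∃ x, (p : ℤ) ^ n ∣ a + b * x := by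
  have hpp : Prime (p : ℤ) := Nat.prime_iff_prime_int.mp hp
  obtain ⟨u, w, huw⟩ : IsCoprime ((p : ℤ) ^ n) b :=
    ((Prime.coprime_iff_not_dvd hpp).mpr hb).pow_left
  exact ⟨-(a * w), a * u, by linear_combination (-a) * huw⟩

/-- A vector that is isotropic modulo `p ^ n` and nonzero modulo `p` is proportional, as a linear
form on the binary quadratic forms, to the evaluation at a point of the projective line. -/
lemma IsFormIsometry.exists_point (hp : p.Prime) (hodd : Odd p) {N : ℕ}
    {Φ : (Fin 3 → ℤ) →+ ℤ × ℤ × ℤ} (hΦ : IsFormIsometry p N Φ) {n : ℕ} (hn : 1 ≤ n) (hnN : n ≤ N)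
    {a : Fin 3 → ℤ} (ha : (p : ℤ) ^ n ∣ a ⬝ᵥ a) {i : Fin 3} (hai : ¬ (p : ℤ) ∣ a i) :
    ∃ ξ : ℤ × ℤ, IsCoprime ξ.1 ξ.2 ∧
      ∀ z, (p : ℤ) ^ n ∣ a ⬝ᵥ z ↔ (p : ℤ) ^ n ∣ formEval (Φ z) ξ := by
  have hpp : Prime (p : ℤ) := Nat.prime_iff_prime_int.mp hp
  have h2 := not_dvd_two hodd hp
  have h4 : ¬ (p : ℤ) ∣ 4 := fun h => (hpp.dvd_or_dvd (show (p : ℤ) ∣ 2 * 2 from h)).elim h2 h2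
  have hdot : ∀ z, (p : ℤ) ^ n ∣ 4 * (a ⬝ᵥ z) - (2 * (Φ a).1 * (Φ z).2.2 +
      2 * (Φ a).2.2 * (Φ z).1 - (Φ a).2.1 * (Φ z).2.1) := fun z =>
    (pow_dvd_pow _ hnN).trans (hΦ.dot a z)
  rcases hw : Φ a with ⟨w₁, w₂, w₃⟩
  simp only [hw] at hdot
  have hnull : (p : ℤ) ^ n ∣ w₂ ^ 2 - 4 * w₁ * w₃ := by
    have h := dvd_sub (hdot a) (ha.mul_left 4)
    rw [hw] at h
    have heq : w₂ ^ 2 - 4 * w₁ * w₃ =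
        4 * (a ⬝ᵥ a) - (2 * w₁ * w₃ + 2 * w₃ * w₁ - w₂ * w₂) - 4 * (a ⬝ᵥ a) := by ring
    rw [heq]
    exact h
  -- a multiple of the linear form `a ⬝ᵥ ·` agrees with a multiple of an evaluation
  have hfinish : ∀ (μ : ℤ) (ξ : ℤ × ℤ), ¬ (p : ℤ) ∣ μ →
      (∀ v : ℤ × ℤ × ℤ, (p : ℤ) ^ n ∣
        μ * formEval v ξ - (2 * w₁ * v.2.2 + 2 * w₃ * v.1 - w₂ * v.2.1)) →
      ∀ z, (p : ℤ) ^ n ∣ a ⬝ᵥ z ↔ (p : ℤ) ^ n ∣ formEval (Φ z) ξ := by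
    intro μ ξ hμ hv z
    have h1 := dvd_sub (hdot z) (hv (Φ z))
    rw [sub_sub_sub_cancel_right] at h1
    constructor
    · intro hz
      exact hpp.pow_dvd_of_dvd_mul_left _ hμ ((dvd_sub_right (hz.mul_left 4)).mp h1)
    · intro hz
      exact hpp.pow_dvd_of_dvd_mul_left _ h4 ((dvd_sub_left (hz.mul_left μ)).mp h1)
  by_cases h1 : (p : ℤ) ∣ w₁
  · by_cases h3 : (p : ℤ) ∣ w₃
    · exfalso
      have hpn : (p : ℤ) ∣ p ^ n := dvd_pow_self _ (by omega)
      have hw2 : (p : ℤ) ∣ w₂ := by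
        refine hpp.dvd_of_dvd_pow (n := 2) ((dvd_sub_left ?_).mp (hpn.trans hnull))
        exact h3.mul_left _
      have h5 := hpn.trans (hdot (Pi.single i 1))
      rw [dotProduct_single_one] at h5
      have h6 : (p : ℤ) ∣ 4 * a i := by
        refine (dvd_sub_left ?_).mp h5
        exact dvd_sub (dvd_add ((h1.mul_left 2).mul_right _) ((h3.mul_left 2).mul_right _))
          (hw2.mul_right _)
      exact (hpp.dvd_or_dvd h6).elim h4 hai
    · have h23 : ¬ (p : ℤ) ∣ 2 * w₃ := fun h => (hpp.dvd_or_dvd h).elim h2 h3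
      obtain ⟨τ, hτ⟩ := exists_dvd_add_mul hp n w₂ h23
      refine ⟨(1, τ), isCoprime_one_left, hfinish (2 * w₃) _ h23 fun v => ?_⟩
      have h5 : (p : ℤ) ^ n ∣ 2 * w₃ * τ ^ 2 - 2 * w₁ := by
        refine hpp.pow_dvd_of_dvd_mul_left _ h23 ?_
        have : 2 * w₃ * (2 * w₃ * τ ^ 2 - 2 * w₁) =
            (w₂ + 2 * w₃ * τ) * (2 * w₃ * τ - w₂) + (w₂ ^ 2 - 4 * w₁ * w₃) := by ring
        rw [this]
        exact dvd_add (hτ.mul_right _) hnull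
      have : 2 * w₃ * formEval v (1, τ) - (2 * w₁ * v.2.2 + 2 * w₃ * v.1 - w₂ * v.2.1) =
          (w₂ + 2 * w₃ * τ) * v.2.1 + (2 * w₃ * τ ^ 2 - 2 * w₁) * v.2.2 := by
        simp only [formEval]; ring
      rw [this]
      exact dvd_add (hτ.mul_right _) (h5.mul_right _)
  · have h21 : ¬ (p : ℤ) ∣ 2 * w₁ := fun h => (hpp.dvd_or_dvd h).elim h2 h1
    obtain ⟨τ, hτ⟩ := exists_dvd_add_mul hp n w₂ h21
    refine ⟨(τ, 1), isCoprime_one_right, hfinish (2 * w₁) _ h21 fun v => ?_⟩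
    have h5 : (p : ℤ) ^ n ∣ 2 * w₁ * τ ^ 2 - 2 * w₃ := by
      refine hpp.pow_dvd_of_dvd_mul_left _ h21 ?_
      have : 2 * w₁ * (2 * w₁ * τ ^ 2 - 2 * w₃) =
          (w₂ + 2 * w₁ * τ) * (2 * w₁ * τ - w₂) + (w₂ ^ 2 - 4 * w₁ * w₃) := by ring
      rw [this]
      exact dvd_add (hτ.mul_right _) hnull
    have : 2 * w₁ * formEval v (τ, 1) - (2 * w₁ * v.2.2 + 2 * w₃ * v.1 - w₂ * v.2.1) =
        (w₂ + 2 * w₁ * τ) * v.2.1 + (2 * w₁ * τ ^ 2 - 2 * w₃) * v.1 := by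
      simp only [formEval]; ring
    rw [this]
    exact dvd_add (hτ.mul_right _) (h5.mul_right _)

end

/-! ### Sublattices of the body centered cubic lattice -/

lemma exists_two_mul_eq_of_mem {x : Fin 3 → ℝ} (hx : x ∈ bccLattice) :
    ∃ z : Fin 3 → ℤ, ∀ i, 2 * x i = z i := by
  obtain ⟨a, k, h⟩ := hx
  refine ⟨fun i => 2 * a i + k, fun i => ?_⟩
  rw [h]
  push_cast
  ring

/-- The vector `2 x`, which is integral, for `x` in the body centered cubic lattice. -/
noncomputable def bccDouble : bccLattice →+ (Fin 3 → ℤ) :=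
  AddMonoidHom.mk' (fun x i => ⌊2 * (x : Fin 3 → ℝ) i⌋) (by
    intro x y
    obtain ⟨z, hz⟩ := exists_two_mul_eq_of_mem x.2
    funext i
    simp only [AddSubgroup.coe_add, Pi.add_apply, mul_add]
    rw [hz i, Int.floor_intCast_add, Int.floor_intCast])

lemma bccDouble_apply (x : bccLattice) (i : Fin 3) :
    2 * (x : Fin 3 → ℝ) i = (bccDouble x i : ℤ) := by
  obtain ⟨z, hz⟩ := exists_two_mul_eq_of_mem x.2
  have : bccDouble x i = z i := by
    change ⌊2 * (x : Fin 3 → ℝ) i⌋ = z i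
    rw [hz i, Int.floor_intCast]
  rw [this, hz]

lemma exists_bccDouble_eq {z : Fin 3 → ℤ} (hz : ∀ i, Even (z i)) : ∃ x, bccDouble x = z := by
  choose a ha using hz
  have hmem : (fun i => (a i : ℝ)) ∈ bccLattice := ⟨a, 0, fun i => by simp⟩
  refine ⟨⟨_, hmem⟩, ?_⟩
  funext i
  have h := bccDouble_apply ⟨_, hmem⟩ i
  simp only at h
  rw [ha i]
  have : (2 * a i : ℤ) = bccDouble ⟨_, hmem⟩ i := by exact_mod_cast h
  rw [← this]
  ring

/-- The lattice of all `x` in the body centered cubic lattice for which the form `Φ (2 x)` belongs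
to `G`. -/
noncomputable def latticeOfForms (Φ : (Fin 3 → ℤ) →+ ℤ × ℤ × ℤ) (G : AddSubgroup (ℤ × ℤ × ℤ)) :
    AddSubgroup (Fin 3 → ℝ) :=
  (G.comap (Φ.comp bccDouble)).map bccLattice.subtype

section
variable {Φ : (Fin 3 → ℤ) →+ ℤ × ℤ × ℤ}

lemma mem_latticeOfForms {G : AddSubgroup (ℤ × ℤ × ℤ)} {x : Fin 3 → ℝ} :
    x ∈ latticeOfForms Φ G ↔ ∃ h : x ∈ bccLattice, Φ (bccDouble ⟨x, h⟩) ∈ G := by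
  simp only [latticeOfForms, AddSubgroup.mem_map, AddSubgroup.mem_comap]
  constructor
  · rintro ⟨y, hy, rfl⟩
    exact ⟨y.2, hy⟩
  · rintro ⟨h, hG⟩
    exact ⟨⟨x, h⟩, hG, rfl⟩

lemma latticeOfForms_inf (G G' : AddSubgroup (ℤ × ℤ × ℤ)) :
    latticeOfForms Φ (G ⊓ G') = latticeOfForms Φ G ⊓ latticeOfForms Φ G' := by
  rw [latticeOfForms, AddSubgroup.comap_inf,
    AddSubgroup.map_inf _ _ _ (AddSubgroup.subtype_injective _)]
  rfl

variable {p N : ℕ}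

lemma IsFormIsometry.exists_bcc (hodd : Odd p) (hΦ : IsFormIsometry p N Φ) (v : ℤ × ℤ × ℤ) :
    ∃ x w, Φ (bccDouble x) = v + (p ^ N : ℕ) • w := by
  obtain ⟨y, w, hy⟩ := hΦ.surj v
  have heven : Even ((p : ℤ) ^ N + 1) := by
    have : Odd ((p : ℤ) ^ N) := by exact_mod_cast hodd.pow
    exact this.add_one
  obtain ⟨x, hx⟩ := exists_bccDouble_eq (z := (p ^ N + 1 : ℕ) • y) (fun i => by
    have := heven.mul_right (y i)
    simpa using this)
  refine ⟨x, v + (p ^ N + 1 : ℕ) • w, ?_⟩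
  rw [hx, map_nsmul, hy]
  module

lemma IsFormIsometry.latticeOfForms_injOn (hodd : Odd p) (hΦ : IsFormIsometry p N Φ)
    {G G' : AddSubgroup (ℤ × ℤ × ℤ)} (hG : ∀ v, (p ^ N : ℕ) • v ∈ G)
    (hG' : ∀ v, (p ^ N : ℕ) • v ∈ G') (h : latticeOfForms Φ G = latticeOfForms Φ G') :
    G = G' := by
  have main : ∀ {G G' : AddSubgroup (ℤ × ℤ × ℤ)}, (∀ v, (p ^ N : ℕ) • v ∈ G) →
      (∀ v, (p ^ N : ℕ) • v ∈ G') → latticeOfForms Φ G = latticeOfForms Φ G' → G ≤ G' := by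
    intro G G' hG hG' h v hv
    obtain ⟨x, w, hx⟩ := hΦ.exists_bcc hodd v
    have h1 : (x : Fin 3 → ℝ) ∈ latticeOfForms Φ G :=
      mem_latticeOfForms.mpr ⟨x.2, by rw [hx]; exact G.add_mem hv (hG w)⟩
    rw [h] at h1
    obtain ⟨_, h2⟩ := mem_latticeOfForms.mp h1
    rw [hx] at h2
    simpa using G'.sub_mem h2 (hG' w)
  exact le_antisymm (main hG hG' h) (main hG' hG h.symm)

lemma IsFormIsometry.relIndex_latticeOfForms (hodd : Odd p) (hΦ : IsFormIsometry p N Φ)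
    {G : AddSubgroup (ℤ × ℤ × ℤ)} (hG : ∀ v, (p ^ N : ℕ) • v ∈ G) :
    (latticeOfForms Φ G).relIndex bccLattice = G.index := by
  have h1 : (latticeOfForms Φ G).addSubgroupOf bccLattice = G.comap (Φ.comp bccDouble) :=
    AddSubgroup.comap_map_eq_self_of_injective (AddSubgroup.subtype_injective _) _
  have h2 : G ⊔ (Φ.comp bccDouble).range = ⊤ := by
    rw [eq_top_iff]
    intro v _
    obtain ⟨x, w, hx⟩ := hΦ.exists_bcc hodd v
    have : v = -((p ^ N : ℕ) • w) + Φ (bccDouble x) := by rw [hx]; abel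
    rw [this]
    exact AddSubgroup.add_mem_sup (G.neg_mem (hG w)) ⟨x, rfl⟩
  rw [AddSubgroup.relIndex, h1, AddSubgroup.index_comap, ← AddSubgroup.relIndex_sup_left, h2,
    AddSubgroup.relIndex_top_right]

lemma nsmul_mem_formsVanishingAt {ξ : ℤ × ℤ} {n : ℕ} (hn : n ≤ N) (v : ℤ × ℤ × ℤ) :
    (p ^ N : ℕ) • v ∈ formsVanishingAt p ξ n := by
  rw [mem_formsVanishingAt]
  have : formEval ((p ^ N : ℕ) • v) ξ = (p : ℤ) ^ N * formEval v ξ := by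
    simp only [formEval, Prod.smul_fst, Prod.smul_snd, smul_eq_mul, Nat.cast_pow,
      ← Nat.cast_smul_eq_nsmul ℤ]
    ring
  rw [this]
  exact (pow_dvd_pow _ hn).mul_right _

lemma index_formsVanishingAt (hp : p.Prime) {ξ : ℤ × ℤ} (hξ : IsCoprime ξ.1 ξ.2) (n : ℕ) :
    (formsVanishingAt p ξ n).index = p ^ n := by
  have h : HasMeet p ξ ξ n 0 0 := ⟨hξ, hξ, by omega, by simp, Or.inl rfl⟩
  have h0 : formsVanishingAt p ξ (0 + 0) = ⊤ := by
    ext v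
    simp [mem_formsVanishingAt]
  have := h.index_inf hp
  rwa [h0, inf_top_eq, add_zero] at this

end

/-! ### Coincidence rotations -/

lemma rotation_mul_transpose (R : specialOrthogonalGroup (Fin 3) ℝ) : R.1 * (R.1)ᵀ = 1 := by
  have h := (mem_orthogonalGroup_iff (Fin 3) ℝ).mp (mem_specialOrthogonalGroup_iff.mp R.2).1
  simpa [star_eq_conjTranspose] using h

lemma rotation_transpose_mul (R : specialOrthogonalGroup (Fin 3) ℝ) : (R.1)ᵀ * R.1 = 1 :=
  mul_eq_one_comm.mp (rotation_mul_transpose R)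

lemma mem_rotatedCopy {R : specialOrthogonalGroup (Fin 3) ℝ} {Γ : AddSubgroup (Fin 3 → ℝ)}
    {x : Fin 3 → ℝ} :
    x ∈ rotatedCopy R Γ ↔ (R.1)ᵀ *ᵥ x ∈ Γ := by
  have h1 := rotation_mul_transpose R
  have h2 := rotation_transpose_mul R
  constructor
  · rintro ⟨y, hy, rfl⟩
    simpa [h2] using hy
  · intro h
    refine ⟨_, h, ?_⟩
    simp [h1]

/-- If `p ^ n R` is integral, then a vector `x` of the body centered cubic lattice belongs to the
rotated lattice as soon as `Rᵀ (2 x)` is integral: its coordinates then all have the same parity,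
since those of `2 x` do and the columns of `p ^ n R` have odd sums. -/
lemma mem_rotatedCopy_bcc_iff {p : ℕ} (hp : p.Prime) (hodd : Odd p)
    {R : specialOrthogonalGroup (Fin 3) ℝ}
    {n : ℕ} {B : Fin 3 → Fin 3 → ℤ} (hB : ∀ i j, (p : ℝ) ^ n * R.1 i j = B i j)
    (x : bccLattice) :
    (x : Fin 3 → ℝ) ∈ rotatedCopy R bccLattice ↔
      ∀ j, (p : ℤ) ^ n ∣ (fun i => B i j) ⬝ᵥ bccDouble x := by
  have h2 := rotation_transpose_mul R
  have hp0 : (p : ℝ) ^ n ≠ 0 := pow_ne_zero _ (by exact_mod_cast hp.ne_zero)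
  have hcoord : ∀ j, (p : ℝ) ^ n * (2 * ((R.1)ᵀ *ᵥ (x : Fin 3 → ℝ)) j) =
      (((fun i => B i j) ⬝ᵥ bccDouble x : ℤ) : ℝ) := by
    intro j
    simp only [mulVec, dotProduct, Fin.sum_univ_three, transpose_apply]
    push_cast
    rw [← hB, ← hB, ← hB, ← bccDouble_apply, ← bccDouble_apply, ← bccDouble_apply]
    ring
  rw [mem_rotatedCopy]
  constructor
  · intro h j
    obtain ⟨z, hz⟩ := exists_two_mul_eq_of_mem h
    refine ⟨z j, ?_⟩
    have := hcoord j
    rw [hz j] at this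
    exact_mod_cast this.symm
  · intro h
    choose w hw using h
    obtain ⟨a, k, hx⟩ := x.2
    have hz : ∀ i, bccDouble x i = 2 * a i + k := by
      intro i
      have := bccDouble_apply x i
      rw [hx i] at this
      have h3 : (2 * a i + k : ℝ) = bccDouble x i := by rw [← this]; ring
      exact_mod_cast h3.symm
    have hpodd : Odd ((p : ℤ) ^ n) := by exact_mod_cast hodd.pow
    have hpar : ∀ j, Even (w j - k) := by
      intro j
      have hcol : (∑ i, B i j * B i j) = (p : ℤ) ^ n * p ^ n := by
        have h4 := congrFun (congrFun h2 j) j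
        rw [mul_apply, one_apply_eq] at h4
        have h5 : ((∑ i, B i j * B i j : ℤ) : ℝ) = (p : ℝ) ^ n * p ^ n := by
          push_cast
          simp only [← hB]
          rw [← mul_one ((p : ℝ) ^ n * p ^ n), ← h4, Finset.mul_sum]
          refine Finset.sum_congr rfl fun i _ => ?_
          rw [transpose_apply]
          ring
        exact_mod_cast h5
      have hwj := hw j
      simp only [dotProduct, Fin.sum_univ_three, hz] at hwj hcol
      have hodd2 := hpodd.mul hpodd
      rw [← hcol] at hodd2
      have hsum : Odd (B 0 j + B 1 j + B 2 j) := by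
        simp only [Int.odd_add, Int.odd_mul, Int.even_mul] at hodd2 ⊢
        tauto
      have h6 : Even ((p : ℤ) ^ n * w j - k * (B 0 j + B 1 j + B 2 j)) := by
        rw [← hwj]
        exact ⟨B 0 j * a 0 + B 1 j * a 1 + B 2 j * a 2, by ring⟩
      rw [Int.even_sub] at h6 ⊢
      rw [Int.even_mul, Int.even_mul] at h6
      have h7 := Int.not_even_iff_odd.mpr hpodd
      have h8 := Int.not_even_iff_odd.mpr hsum
      tauto
    choose b hb using hpar
    refine ⟨b, k, fun j => ?_⟩
    have h9 := hcoord j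
    rw [hw j] at h9
    push_cast at h9
    have h10 := mul_left_cancel₀ hp0 h9
    have h11 : (w j : ℝ) = b j + b j + k := by
      have := hb j
      have : w j = b j + b j + k := by omega
      exact_mod_cast this
    rw [h11] at h10
    linarith

section
variable {p N : ℕ} {Φ : (Fin 3 → ℤ) →+ ℤ × ℤ × ℤ}

lemma int_even_of_four_dvd_sum_sq {a b c : ℤ} (h : (4 : ℤ) ∣ a * a + b * b + c * c) :
    Even a ∧ Even b ∧ Even c := by
  have key : ∀ x : ℤ, x * x % 4 = if Even x then 0 else 1 := by
    intro x
    split_ifs with hx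
    · obtain ⟨y, rfl⟩ := hx
      rw [show (y + y) * (y + y) = 4 * (y * y) by ring]
      omega
    · obtain ⟨y, rfl⟩ := Int.not_even_iff_odd.mp hx
      rw [show (2 * y + 1) * (2 * y + 1) = 4 * (y * y + y) + 1 by ring]
      omega
  have ha := key a
  have hb := key b
  have hc := key c
  split_ifs at ha hb hc <;> first | exact ⟨‹_›, ‹_›, ‹_›⟩ | omega

/-- If `p ^ r Γ ⊆ R Γ`, then the matrix `p ^ r R` is integral. A priori its entries are only half
integers, but the squares in each row of `2 p ^ r R` add up to a multiple of four. -/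
lemma exists_int_matrix {r : ℕ} {R : specialOrthogonalGroup (Fin 3) ℝ}
    (h : ∀ x ∈ bccLattice, (p ^ r : ℕ) • x ∈ rotatedCopy R bccLattice) :
    ∃ B : Fin 3 → Fin 3 → ℤ, ∀ i j, (p : ℝ) ^ r * R.1 i j = B i j := by
  have hentry : ∀ i j, ∃ m : ℤ, 2 * ((p : ℝ) ^ r * R.1 i j) = m := by
    intro i j
    have hmem : (Pi.single i 1 : Fin 3 → ℝ) ∈ bccLattice := by
      refine ⟨Pi.single i 1, 0, fun j => ?_⟩
      by_cases hij : j = i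
      · subst hij; simp
      · simp [hij]
    have h1 := mem_rotatedCopy.mp (h _ hmem)
    obtain ⟨z, hz⟩ := exists_two_mul_eq_of_mem h1
    refine ⟨z j, ?_⟩
    rw [← hz j, mulVec_smul]
    simp
  choose M hM using hentry
  have hrow : ∀ i, M i 0 * M i 0 + M i 1 * M i 1 + M i 2 * M i 2 = 4 * ((p : ℤ) ^ r * p ^ r) := by
    intro i
    have h1 := congrFun (congrFun (rotation_mul_transpose R) i) i
    rw [mul_apply, one_apply_eq, Fin.sum_univ_three] at h1
    simp only [transpose_apply] at h1
    have h2 : (M i 0 * M i 0 + M i 1 * M i 1 + M i 2 * M i 2 : ℝ) =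
        4 * ((p : ℝ) ^ r * p ^ r) := by
      rw [← hM, ← hM, ← hM]
      linear_combination (4 * ((p : ℝ) ^ r * p ^ r)) * h1
    exact_mod_cast h2
  have heven : ∀ i j, Even (M i j) := by
    intro i j
    obtain ⟨h0, h1, h2⟩ := int_even_of_four_dvd_sum_sq ⟨_, hrow i⟩
    fin_cases j
    exacts [h0, h1, h2]
  choose B hB using heven
  refine ⟨B, fun i j => ?_⟩
  have h1 := hM i j
  rw [hB] at h1
  push_cast at h1
  linarith

/-- The `2 × 2` minors of `q R` are, up to sign, `q` times entries of `q R`, because a rotation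
matrix is its own cofactor matrix. -/
lemma dvd_minor {q : ℤ} (hq : q ≠ 0) {R : specialOrthogonalGroup (Fin 3) ℝ}
    {B : Fin 3 → Fin 3 → ℤ} (hB : ∀ i j, (q : ℝ) * R.1 i j = B i j) (i i' j j' : Fin 3) :
    q ∣ B i j * B i' j' - B i j' * B i' j := by
  have hadj : (R.1).adjugate = (R.1)ᵀ := by
    have h1 := mul_adjugate R.1
    rw [(mem_specialOrthogonalGroup_iff.mp R.2).2, one_smul] at h1
    calc (R.1).adjugate = ((R.1)ᵀ * R.1) * (R.1).adjugate := by
          rw [rotation_transpose_mul, one_mul]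
      _ = (R.1)ᵀ := by rw [Matrix.mul_assoc, h1, mul_one]
  have hq' : (q : ℝ) ≠ 0 := by exact_mod_cast hq
  have hminor : ∀ (a b c d k l : Fin 3) (ε : ℤ),
      R.1 a b * R.1 c d - R.1 a d * R.1 c b = ε * R.1 k l →
      q ∣ B a b * B c d - B a d * B c b := by
    intro a b c d k l ε h
    refine ⟨ε * B k l, ?_⟩
    have : (B a b * B c d - B a d * B c b : ℝ) = q * (ε * B k l) := by
      simp only [← hB]
      linear_combination (q : ℝ) ^ 2 * h
    exact_mod_cast this
  have hentry := fun k l => congrFun (congrFun hadj k) l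
  simp only [adjugate_fin_three, transpose_apply] at hentry
  -- the minors with increasing rows and columns
  have hrows : ∀ a c : Fin 3, a < c → ∀ b d : Fin 3, b < d →
      q ∣ B a b * B c d - B a d * B c b := by
    intro a c hac b d hbd
    have h00 := hentry 0 0
    have h01 := hentry 0 1
    have h02 := hentry 0 2
    have h10 := hentry 1 0
    have h11 := hentry 1 1
    have h12 := hentry 1 2
    have h20 := hentry 2 0
    have h21 := hentry 2 1
    have h22 := hentry 2 2
    simp at h00 h01 h02 h10 h11 h12 h20 h21 h22
    fin_cases a <;> fin_cases c <;> simp at hac <;> fin_cases b <;> fin_cases d <;> simp at hbd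
    exacts [hminor 0 0 1 1 2 2 1 (by push_cast; linarith),
      hminor 0 0 1 2 2 1 (-1) (by push_cast; linarith),
      hminor 0 1 1 2 2 0 1 (by push_cast; linarith),
      hminor 0 0 2 1 1 2 (-1) (by push_cast; linarith),
      hminor 0 0 2 2 1 1 1 (by push_cast; linarith),
      hminor 0 1 2 2 1 0 (-1) (by push_cast; linarith),
      hminor 1 0 2 1 0 2 1 (by push_cast; linarith),
      hminor 1 0 2 2 0 1 (-1) (by push_cast; linarith),
      hminor 1 1 2 2 0 0 1 (by push_cast; linarith)]
  have hcols : ∀ a c : Fin 3, a < c → ∀ b d : Fin 3, q ∣ B a b * B c d - B a d * B c b := by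
    intro a c hac b d
    rcases lt_trichotomy b d with hbd | rfl | hbd
    · exact hrows a c hac b d hbd
    · simp
    · rw [← dvd_neg, neg_sub]
      exact hrows a c hac d b hbd
  rcases lt_trichotomy i i' with hi | rfl | hi
  · exact hcols i i' hi j j'
  · rw [mul_comm]; simp
  · rw [← dvd_neg, neg_sub, mul_comm (B i j'), mul_comm (B i j)]
    exact hcols i' i hi j j'

/-- An ordinary coincidence site lattice that contains `p ^ r Γ` consists of the vectors whose forms
vanish at some point modulo `p ^ n`. Indeed, if `n` is minimal such that `p ^ n R` is integral, this
matrix has rank one modulo `p ^ n`, and each of its columns is isotropic modulo `p ^ n`. -/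
theorem exists_point_of_rotation (hp : p.Prime) (hodd : Odd p) (hΦ : IsFormIsometry p N Φ)
    {r : ℕ} (hr : r ≤ N) {R : specialOrthogonalGroup (Fin 3) ℝ}
    (h : ∀ x ∈ bccLattice, (p ^ r : ℕ) • x ∈ rotatedCopy R bccLattice) :
    ∃ ξ : ℤ × ℤ, ∃ n ≤ r, IsCoprime ξ.1 ξ.2 ∧
      bccLattice ⊓ rotatedCopy R bccLattice = latticeOfForms Φ (formsVanishingAt p ξ n) := by
  classical
  have hpp : Prime (p : ℤ) := Nat.prime_iff_prime_int.mp hp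
  have hex : ∃ n, ∃ B : Fin 3 → Fin 3 → ℤ, ∀ i j, (p : ℝ) ^ n * R.1 i j = B i j :=
    ⟨r, exists_int_matrix h⟩
  set n := Nat.find hex with hn
  have hnr : n ≤ r := Nat.find_min' hex (exists_int_matrix h)
  obtain ⟨B, hB⟩ : ∃ B : Fin 3 → Fin 3 → ℤ, ∀ i j, (p : ℝ) ^ n * R.1 i j = B i j :=
    Nat.find_spec hex
  suffices hs : ∃ ξ : ℤ × ℤ, IsCoprime ξ.1 ξ.2 ∧ ∀ x : bccLattice,
      (∀ j, (p : ℤ) ^ n ∣ (fun i => B i j) ⬝ᵥ bccDouble x) ↔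
        (p : ℤ) ^ n ∣ formEval (Φ (bccDouble x)) ξ by
    obtain ⟨ξ, hξ, hs⟩ := hs
    refine ⟨ξ, n, hnr, hξ, ?_⟩
    ext x
    rw [AddSubgroup.mem_inf, mem_latticeOfForms]
    constructor
    · rintro ⟨hx, hRx⟩
      exact ⟨hx, (hs ⟨x, hx⟩).mp ((mem_rotatedCopy_bcc_iff hp hodd hB ⟨x, hx⟩).mp hRx)⟩
    · rintro ⟨hx, hG⟩
      exact ⟨hx, (mem_rotatedCopy_bcc_iff hp hodd hB ⟨x, hx⟩).mpr ((hs ⟨x, hx⟩).mpr hG)⟩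
  rcases Nat.eq_zero_or_pos n with h0 | hpos
  · exact ⟨(1, 0), isCoprime_one_left, fun x => by simp [h0]⟩
  obtain ⟨i₀, j₀, hij⟩ : ∃ i j, ¬ (p : ℤ) ∣ B i j := by
    by_contra! hcon
    choose C hC using hcon
    refine Nat.find_min hex (show n - 1 < n by omega) ⟨C, fun i j => ?_⟩
    have hp0 : (p : ℝ) ≠ 0 := by exact_mod_cast hp.ne_zero
    have h1 := hB i j
    rw [hC, show n = (n - 1) + 1 by omega, pow_succ'] at h1
    push_cast at h1
    rw [mul_assoc] at h1
    exact mul_left_cancel₀ hp0 h1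
  have hnull : (p : ℤ) ^ n ∣ (fun i => B i j₀) ⬝ᵥ (fun i => B i j₀) := by
    refine ⟨p ^ n, ?_⟩
    have h1 := congrFun (congrFun (rotation_transpose_mul R) j₀) j₀
    rw [mul_apply, one_apply_eq] at h1
    have h2 : ((∑ i, B i j₀ * B i j₀ : ℤ) : ℝ) = (p : ℝ) ^ n * p ^ n := by
      push_cast
      simp only [← hB]
      rw [← mul_one ((p : ℝ) ^ n * p ^ n), ← h1, Finset.mul_sum]
      refine Finset.sum_congr rfl fun i _ => ?_
      rw [transpose_apply]
      ring
    exact_mod_cast h2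
  obtain ⟨ξ, hξ, hev⟩ := hΦ.exists_point hp hodd hpos (hnr.trans hr) hnull hij
  refine ⟨ξ, hξ, fun x => ?_⟩
  rw [← hev]
  refine ⟨fun hall => hall j₀, fun hj₀ j => ?_⟩
  -- all columns are multiples of the column `j₀` modulo `p ^ n`
  refine hpp.pow_dvd_of_dvd_mul_left _ hij ?_
  have hminor := fun i => dvd_minor (q := (p : ℤ) ^ n) (pow_ne_zero _ hpp.ne_zero)
    (R := R) (B := B) (fun i j => by push_cast; exact hB i j) i₀ i j₀ j
  set z := bccDouble x
  have heq : B i₀ j₀ * ((fun i => B i j) ⬝ᵥ z) = B i₀ j * ((fun i => B i j₀) ⬝ᵥ z) +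
      ∑ i, (B i₀ j₀ * B i j - B i₀ j * B i j₀) * z i := by
    simp only [dotProduct, Fin.sum_univ_three]
    ring
  rw [heq]
  exact dvd_add (hj₀.mul_left _) (Finset.dvd_sum fun i _ => (hminor i).mul_right _)

end

/-! ### Realizing points by rotations -/

section
variable {p N : ℕ} {Φ : (Fin 3 → ℤ) →+ ℤ × ℤ × ℤ}

lemma formEval_add (v w : ℤ × ℤ × ℤ) (ξ : ℤ × ℤ) :
    formEval (v + w) ξ = formEval v ξ + formEval w ξ := by
  simp only [formEval, Prod.fst_add, Prod.snd_add]; ring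

lemma formPolar_add (v w : ℤ × ℤ × ℤ) (ξ η : ℤ × ℤ) :
    formPolar (v + w) ξ η = formPolar v ξ η + formPolar w ξ η := by
  simp only [formPolar, Prod.fst_add, Prod.snd_add]; ring

lemma formEval_zsmul (k : ℤ) (v : ℤ × ℤ × ℤ) (ξ : ℤ × ℤ) :
    formEval (k • v) ξ = k * formEval v ξ := by
  simp only [formEval, Prod.smul_fst, Prod.smul_snd, smul_eq_mul]; ring

lemma formPolar_zsmul (k : ℤ) (v : ℤ × ℤ × ℤ) (ξ η : ℤ × ℤ) :
    formPolar (k • v) ξ η = k * formPolar v ξ η := by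
  simp only [formPolar, Prod.smul_fst, Prod.smul_snd, smul_eq_mul]; ring

/-- The polarized discriminant is invariant under changes of basis of determinant one. -/
lemma discr_polar_eq {ξ ξ' : ℤ × ℤ} (h : pairDet ξ ξ' = 1) (v w : ℤ × ℤ × ℤ) :
    2 * v.1 * w.2.2 + 2 * v.2.2 * w.1 - v.2.1 * w.2.1 =
      2 * formEval v ξ * formEval w ξ' + 2 * formEval v ξ' * formEval w ξ
        - formPolar v ξ ξ' * formPolar w ξ ξ' := by
  have key : pairDet ξ ξ' ^ 2 * (2 * v.1 * w.2.2 + 2 * v.2.2 * w.1 - v.2.1 * w.2.1) =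
      2 * formEval v ξ * formEval w ξ' + 2 * formEval v ξ' * formEval w ξ
        - formPolar v ξ ξ' * formPolar w ξ ξ' := by
    simp only [pairDet, formEval, formPolar]; ring
  rw [← key, h]; ring

/-- The sublattice `q Λ` of `ℤ³` that consists of the vectors whose forms are divisible by `q ^ 2`
at `ξ` and have polar form divisible by `q` at `ξ`, `ξ'`. The lattice `Λ` is the `q`-neighbour of
`ℤ³` at the point `ξ`. -/
def scaledNeighbor (Φ : (Fin 3 → ℤ) →+ ℤ × ℤ × ℤ) (q : ℤ) (ξ ξ' : ℤ × ℤ) :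
    AddSubgroup (Fin 3 → ℤ) where
  carrier := {z | q ^ 2 ∣ formEval (Φ z) ξ ∧ q ∣ formPolar (Φ z) ξ ξ'}
  zero_mem' := by simp [formEval, formPolar]
  add_mem' := by
    rintro x y ⟨hx, hx'⟩ ⟨hy, hy'⟩
    exact ⟨by rw [map_add, formEval_add]; exact dvd_add hx hy,
      by rw [map_add, formPolar_add]; exact dvd_add hx' hy'⟩
  neg_mem' := by
    rintro x ⟨hx, hx'⟩
    rw [Set.mem_ofPred_eq, ← neg_one_zsmul, map_zsmul, formEval_zsmul, formPolar_zsmul]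
    exact ⟨hx.mul_left _, hx'.mul_left _⟩

lemma mem_scaledNeighbor {q : ℤ} {ξ ξ' : ℤ × ℤ} {z : Fin 3 → ℤ} :
    z ∈ scaledNeighbor Φ q ξ ξ' ↔ q ^ 2 ∣ formEval (Φ z) ξ ∧ q ∣ formPolar (Φ z) ξ ξ' := Iff.rfl

/-- The lattice `q⁻¹ T`. -/
def scaleDown (q : ℤ) (T : AddSubgroup (Fin 3 → ℤ)) : AddSubgroup (Fin 3 → ℝ) where
  carrier := {x | ∃ z ∈ T, ∀ i, (q : ℝ) * x i = z i}
  zero_mem' := ⟨0, T.zero_mem, by simp⟩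
  add_mem' := by
    rintro x y ⟨z, hz, hx⟩ ⟨w, hw, hy⟩
    refine ⟨z + w, T.add_mem hz hw, fun i => ?_⟩
    rw [Pi.add_apply, mul_add, hx, hy]
    simp
  neg_mem' := by
    rintro x ⟨z, hz, hx⟩
    refine ⟨-z, T.neg_mem hz, fun i => ?_⟩
    rw [Pi.neg_apply, mul_neg, hx]
    simp

lemma mem_scaleDown {q : ℤ} {T : AddSubgroup (Fin 3 → ℤ)} {x : Fin 3 → ℝ} :
    x ∈ scaleDown q T ↔ ∃ z ∈ T, ∀ i, (q : ℝ) * x i = z i := Iff.rfl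

lemma single_mem_scaleDown (q : ℤ) (ξ ξ' : ℤ × ℤ) (i : Fin 3) :
    Pi.single i (q : ℝ) ∈ scaleDown q (scaledNeighbor Φ q ξ ξ') := by
  refine ⟨(q ^ 2) • Pi.single i 1, ?_, fun j => ?_⟩
  · rw [mem_scaledNeighbor, map_zsmul, formEval_zsmul, formPolar_zsmul]
    exact ⟨dvd_mul_right _ _, (dvd_pow_self q two_ne_zero).mul_right _⟩
  · by_cases hij : j = i
    · subst hij; simp; ring
    · simp [hij]

lemma mul_mul_dotProduct {q : ℤ} {x y : Fin 3 → ℝ} {z w : Fin 3 → ℤ}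
    (hx : ∀ i, (q : ℝ) * x i = z i) (hy : ∀ i, (q : ℝ) * y i = w i) :
    (q : ℝ) * q * (x ⬝ᵥ y) = ((z ⬝ᵥ w : ℤ) : ℝ) := by
  simp only [dotProduct, Fin.sum_univ_three]
  push_cast
  rw [← hx, ← hx, ← hx, ← hy, ← hy, ← hy]
  ring

lemma pow_dvd_of_dvd_four_mul (hp : p.Prime) (hodd : Odd p) {n : ℕ} {x : ℤ}
    (h : (p : ℤ) ^ n ∣ 4 * x) : (p : ℤ) ^ n ∣ x := by
  have hpp : Prime (p : ℤ) := Nat.prime_iff_prime_int.mp hp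
  have h2 := not_dvd_two hodd hp
  refine hpp.pow_dvd_of_dvd_mul_left _ (a := 4) (fun h => ?_) h
  exact (hpp.dvd_or_dvd (show (p : ℤ) ∣ 2 * 2 from h)).elim h2 h2

lemma IsFormIsometry.isIntegralLattice (hp : p.Prime) (hodd : Odd p) (hΦ : IsFormIsometry p N Φ)
    {n : ℕ} (hn : 2 * n ≤ N) {ξ ξ' : ℤ × ℤ} (h : pairDet ξ ξ' = 1) :
    IsIntegralLattice (scaleDown (p ^ n) (scaledNeighbor Φ (p ^ n) ξ ξ')) := by
  rintro x ⟨z, ⟨hz, hz'⟩, hx⟩ y ⟨w, ⟨hw, hw'⟩, hy⟩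
  have hd : ((p : ℤ) ^ n) ^ 2 ∣ z ⬝ᵥ w := by
    rw [← pow_mul]
    refine pow_dvd_of_dvd_four_mul hp hodd ?_
    rw [pow_mul]
    have h1 : ((p : ℤ) ^ n) ^ 2 ∣ p ^ N := by
      rw [← pow_mul]; exact pow_dvd_pow _ (by omega)
    refine (dvd_sub_left ?_).mp (h1.trans (hΦ.dot z w))
    rw [discr_polar_eq h]
    refine dvd_sub (dvd_add ((hz.mul_left 2).mul_right _) (hw.mul_left _)) ?_
    rw [sq]
    exact mul_dvd_mul hz' hw'
  obtain ⟨k, hk⟩ := hd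
  refine ⟨k, ?_⟩
  have h2 := mul_mul_dotProduct hx hy
  have hp0 : (((p : ℤ) ^ n : ℤ) : ℝ) ≠ 0 := by
    exact_mod_cast pow_ne_zero _ hp.ne_zero
  rw [hk] at h2
  push_cast at h2 hp0
  rw [← sq] at h2
  exact mul_left_cancel₀ (pow_ne_zero 2 hp0) h2

lemma IsFormIsometry.containsDual (hp : p.Prime) (hodd : Odd p) (hΦ : IsFormIsometry p N Φ)
    {n : ℕ} (hn : 2 * n ≤ N) {ξ ξ' : ℤ × ℤ} (h : pairDet ξ ξ' = 1) :
    ContainsDual (scaleDown (p ^ n) (scaledNeighbor Φ (p ^ n) ξ ξ')) := by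
  intro y hy
  have hpp : Prime (p : ℤ) := Nat.prime_iff_prime_int.mp hp
  set q : ℤ := (p : ℤ) ^ n with hq
  have hq0 : q ≠ 0 := pow_ne_zero _ hpp.ne_zero
  have hq0' : (q : ℝ) ≠ 0 := by exact_mod_cast hq0
  have hqN : q ^ 2 ∣ (p : ℤ) ^ N := by
    rw [hq, ← pow_mul]; exact pow_dvd_pow _ (by omega)
  -- `q ℤ³` is contained in the lattice, so that `q y` is integral
  have hint : ∀ i, ∃ k : ℤ, (q : ℝ) * y i = k := by
    intro i
    have hmem := single_mem_scaleDown (Φ := Φ) q ξ ξ' i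
    obtain ⟨k, hk⟩ := hy _ hmem
    refine ⟨k, ?_⟩
    rw [← hk, dotProduct_single, mul_comm]
  choose z hz using hint
  have hpair : ∀ w ∈ scaledNeighbor Φ q ξ ξ', q ^ 2 ∣ z ⬝ᵥ w := by
    intro w hw
    have hmem : (fun i => (w i : ℝ) / q) ∈ scaleDown q (scaledNeighbor Φ q ξ ξ') :=
      ⟨w, hw, fun i => by field_simp⟩
    obtain ⟨k, hk⟩ := hy _ hmem
    refine ⟨k, ?_⟩
    have h1 := mul_mul_dotProduct (w := w) hz
      (fun i => by field_simp : ∀ i, (q : ℝ) * (w i / q) = w i)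
    rw [hk] at h1
    have h2 : (z ⬝ᵥ w : ℤ) = q * q * k := by exact_mod_cast h1.symm
    rw [h2, sq]
  have hdisc : ∀ w ∈ scaledNeighbor Φ q ξ ξ', q ^ 2 ∣
      2 * formEval (Φ z) ξ * formEval (Φ w) ξ' + 2 * formEval (Φ z) ξ' * formEval (Φ w) ξ
        - formPolar (Φ z) ξ ξ' * formPolar (Φ w) ξ ξ' := by
    intro w hw
    rw [← discr_polar_eq h]
    exact (dvd_sub_right ((hpair w hw).mul_left 4)).mp (hqN.trans (hΦ.dot z w))
  -- pair with lattice vectors whose forms are congruent to `b X Y + c Y²` in the basis `ξ`, `ξ'`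
  have htest : ∀ b c : ℤ, q ∣ b → q ^ 2 ∣ 2 * formEval (Φ z) ξ * c - formPolar (Φ z) ξ ξ' * b := by
    intro b c hb
    obtain ⟨w, u, hw⟩ := hΦ.surj (formOfBasis ξ ξ' 0 b c)
    have hw2 : Φ w = formOfBasis ξ ξ' 0 b c + (p ^ N : ℤ) • u := by
      rw [hw, ← Nat.cast_smul_eq_nsmul ℤ]
      push_cast
      rfl
    have e1 : formEval (Φ w) ξ = p ^ N * formEval u ξ := by
      rw [hw2, formEval_add, formEval_zsmul, formEval_formOfBasis, pairDet_self]; ring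
    have e2 : formEval (Φ w) ξ' = c + p ^ N * formEval u ξ' := by
      rw [hw2, formEval_add, formEval_zsmul, formEval_formOfBasis, pairDet_self, h]; ring
    have e3 : formPolar (Φ w) ξ ξ' = b + p ^ N * formPolar u ξ ξ' := by
      rw [hw2, formPolar_add, formPolar_zsmul, formPolar_formOfBasis, h]; ring
    have hmem : w ∈ scaledNeighbor Φ q ξ ξ' := by
      rw [mem_scaledNeighbor, e1, e3]
      exact ⟨hqN.mul_right _,
        dvd_add hb (((dvd_pow_self q two_ne_zero).trans hqN).mul_right _)⟩
    have h1 := hdisc w hmem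
    rw [e1, e2, e3] at h1
    obtain ⟨e, he⟩ := hqN
    rw [he] at h1
    have heq : 2 * formEval (Φ z) ξ * c - formPolar (Φ z) ξ ξ' * b =
        2 * formEval (Φ z) ξ * (c + q ^ 2 * e * formEval u ξ')
          + 2 * formEval (Φ z) ξ' * (q ^ 2 * e * formEval u ξ)
          - formPolar (Φ z) ξ ξ' * (b + q ^ 2 * e * formPolar u ξ ξ')
        - q ^ 2 * (e * (2 * formEval (Φ z) ξ * formEval u ξ' +
          2 * formEval (Φ z) ξ' * formEval u ξ - formPolar (Φ z) ξ ξ' * formPolar u ξ ξ')) := by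
      ring
    rw [heq]
    exact dvd_sub h1 (dvd_mul_right _ _)
  refine ⟨z, ⟨?_, ?_⟩, hz⟩
  · have h1 := htest 0 2 (dvd_zero _)
    rw [hq, ← pow_mul] at h1 ⊢
    refine pow_dvd_of_dvd_four_mul hp hodd ?_
    convert h1 using 1
    ring
  · have h1 := htest q 0 dvd_rfl
    rw [mul_zero, zero_sub, dvd_neg, sq, mul_dvd_mul_iff_right hq0] at h1
    exact h1

/-- By the pigeonhole principle the `q`-neighbour, which has covolume one, contains a nonzero vector
in the box `[-1, 1] × (-1, 1) × (-1, 1)`. -/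
lemma exists_short (hp : p.Prime) (n : ℕ) (ξ ξ' : ℤ × ℤ) :
    ∃ x ∈ scaleDown (p ^ n) (scaledNeighbor Φ (p ^ n) ξ ξ'), x ≠ 0 ∧ x ⬝ᵥ x < 3 := by
  classical
  have hpos : 0 < p ^ n := pow_pos hp.pos n
  have : NeZero (p ^ n) := ⟨hpos.ne'⟩
  have : NeZero ((p ^ n) ^ 2) := ⟨(pow_pos hpos 2).ne'⟩
  let ψ : (Fin 3 → ℤ) →+ ZMod ((p ^ n) ^ 2) × ZMod (p ^ n) := AddMonoidHom.mk'
    (fun z => ((formEval (Φ z) ξ : ℤ), ((formPolar (Φ z) ξ ξ' : ℤ) : ZMod (p ^ n))))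
    (by
      intro z w
      ext
      · simp only [map_add, formEval_add, Int.cast_add, Prod.fst_add]
      · simp only [map_add, formPolar_add, Int.cast_add, Prod.snd_add])
  have hker : ∀ z, ψ z = 0 → z ∈ scaledNeighbor Φ (p ^ n) ξ ξ' := by
    intro z hz
    simp only [ψ, AddMonoidHom.mk'_apply, Prod.mk_eq_zero, ZMod.intCast_zmod_eq_zero_iff_dvd] at hz
    push_cast at hz
    exact hz
  let box : Finset (ℕ × ℕ × ℕ) := Finset.range (p ^ n + 1) ×ˢ Finset.range (p ^ n) ×ˢ
    Finset.range (p ^ n)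
  let f : ℕ × ℕ × ℕ → ZMod ((p ^ n) ^ 2) × ZMod (p ^ n) := fun t =>
    ψ ![(t.1 : ℤ), (t.2.1 : ℤ), (t.2.2 : ℤ)]
  have hcard : (Finset.univ : Finset (ZMod ((p ^ n) ^ 2) × ZMod (p ^ n))).card < box.card := by
    rw [Finset.card_univ, Fintype.card_prod, ZMod.card, ZMod.card, Finset.card_product,
      Finset.card_product, Finset.card_range, Finset.card_range]
    have := Nat.mul_pos hpos hpos
    nlinarith
  obtain ⟨s, hs, t, ht, hst, hf⟩ := Finset.exists_ne_map_eq_of_card_lt_of_maps_to hcard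
    (f := f) (fun _ _ => Finset.mem_univ _)
  simp only [box, Finset.mem_product, Finset.mem_range] at hs ht
  set q : ℤ := (p : ℤ) ^ n with hq
  have hqn : ((p ^ n : ℕ) : ℤ) = q := by push_cast; rfl
  have hq0 : 0 < q := by rw [← hqn]; exact_mod_cast hpos
  have hq0' : (0 : ℝ) < q := by exact_mod_cast hq0
  let z : Fin 3 → ℤ := ![(s.1 : ℤ) - t.1, (s.2.1 : ℤ) - t.2.1, (s.2.2 : ℤ) - t.2.2]
  have hz : z ∈ scaledNeighbor Φ q ξ ξ' := by
    refine hker z ?_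
    have : z = ![(s.1 : ℤ), (s.2.1 : ℤ), (s.2.2 : ℤ)] - ![(t.1 : ℤ), (t.2.1 : ℤ), (t.2.2 : ℤ)] := by
      funext i; fin_cases i <;> simp [z]
    rw [this, map_sub]
    exact sub_eq_zero.mpr hf
  have hz0 : z ≠ 0 := by
    intro h0
    have e0 := congrFun h0 0
    have e1 := congrFun h0 1
    have e2 := congrFun h0 2
    simp [z] at e0 e1 e2
    apply hst
    ext <;> omega
  have hbound : z ⬝ᵥ z < 3 * (q * q) := by
    have hz0 : -q ≤ z 0 ∧ z 0 ≤ q := by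
      have e : z 0 = (s.1 : ℤ) - t.1 := rfl
      rw [e, ← hqn]
      omega
    have hz1 : -q < z 1 ∧ z 1 < q := by
      have e : z 1 = (s.2.1 : ℤ) - t.2.1 := rfl
      rw [e, ← hqn]
      omega
    have hz2 : -q < z 2 ∧ z 2 < q := by
      have e : z 2 = (s.2.2 : ℤ) - t.2.2 := rfl
      rw [e, ← hqn]
      omega
    have b0 : 0 ≤ (q - z 0) * (q + z 0) := mul_nonneg (by linarith) (by linarith)
    have b1 : 0 < (q - z 1) * (q + z 1) := mul_pos (by linarith) (by linarith)
    have b2 : 0 < (q - z 2) * (q + z 2) := mul_pos (by linarith) (by linarith)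
    simp only [dotProduct, Fin.sum_univ_three]
    nlinarith
  have hqx : ∀ i, (q : ℝ) * ((z i : ℝ) / q) = z i := fun i => by field_simp
  refine ⟨fun i => (z i : ℝ) / q, ⟨z, hz, hqx⟩, fun h0 => hz0 ?_, ?_⟩
  · funext i
    have := hqx i
    rw [show (z i : ℝ) / q = 0 from congrFun h0 i, mul_zero] at this
    exact_mod_cast this.symm
  · have h1 := mul_mul_dotProduct hqx hqx
    have h2 : ((z ⬝ᵥ z : ℤ) : ℝ) < 3 * (q * q) := by exact_mod_cast hbound
    rw [← h1] at h2
    have hqq : (0 : ℝ) < q * q := mul_pos hq0' hq0'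
    nlinarith

/-- Every point modulo `p ^ n` comes from a rotation, because the `p ^ n`-neighbour of `ℤ³` at this
point is unimodular and hence a rotated copy of `ℤ³`. -/
theorem exists_rotation_of_point (hp : p.Prime) (hodd : Odd p) (hΦ : IsFormIsometry p N Φ)
    {n : ℕ} (hn : 2 * n ≤ N) {ξ : ℤ × ℤ} (hξ : IsCoprime ξ.1 ξ.2) :
    ∃ R : specialOrthogonalGroup (Fin 3) ℝ, IsCoincidenceRotation bccLattice R ∧
      bccLattice ⊓ rotatedCopy R bccLattice = latticeOfForms Φ (formsVanishingAt p ξ n) := by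
  obtain ⟨ξ', h⟩ := exists_pairDet_eq_one hξ
  have hpp : Prime (p : ℤ) := Nat.prime_iff_prime_int.mp hp
  set q : ℤ := (p : ℤ) ^ n with hq
  have hq0 : q ≠ 0 := pow_ne_zero _ hpp.ne_zero
  have hq0' : (q : ℝ) ≠ 0 := by exact_mod_cast hq0
  obtain ⟨R, hR, hΛ⟩ := exists_rotation_of_unimodular (hΦ.isIntegralLattice hp hodd hn h)
    (hΦ.containsDual hp hodd hn h) hq0 (fun x ⟨z, _, hz⟩ => ⟨z, hz⟩) (exists_short hp n ξ ξ')
  have hB : ∀ i, ∃ z : Fin 3 → ℤ, ∀ j, (p : ℝ) ^ n * R i j = z j := by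
    intro i
    have hmem := single_mem_scaleDown (Φ := Φ) q ξ ξ' i
    obtain ⟨z, hz⟩ := (hΛ _).mp hmem
    refine ⟨z, fun j => ?_⟩
    have := congrFun hz j
    simp only [mulVec_single, Pi.smul_apply, col_apply, transpose_apply,
      MulOpposite.smul_eq_mul_unop, MulOpposite.unop_op] at this
    rw [← this, hq]
    push_cast
    ring
  choose B hB using hB
  have hint : bccLattice ⊓ rotatedCopy ⟨R, hR⟩ bccLattice =
      latticeOfForms Φ (formsVanishingAt p ξ n) := by
    ext x
    rw [AddSubgroup.mem_inf, mem_latticeOfForms]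
    suffices hs : ∀ hx : x ∈ bccLattice, x ∈ rotatedCopy ⟨R, hR⟩ bccLattice ↔
        Φ (bccDouble ⟨x, hx⟩) ∈ formsVanishingAt p ξ n from
      ⟨fun hx => ⟨hx.1, (hs hx.1).mp hx.2⟩, fun ⟨hx, hG⟩ => ⟨hx, (hs hx).mpr hG⟩⟩
    intro hx
    rw [mem_rotatedCopy_bcc_iff hp hodd (R := ⟨R, hR⟩) (B := B) hB ⟨x, hx⟩, mem_formsVanishingAt]
    set z := bccDouble ⟨x, hx⟩ with hz
    have hx2 : ∀ i, (2 : ℝ) * x i = z i := fun i => bccDouble_apply ⟨x, hx⟩ i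
    have hcoord : ∀ j, (q : ℝ) * (Rᵀ *ᵥ fun i => (z i : ℝ)) j =
        (((fun i => B i j) ⬝ᵥ z : ℤ) : ℝ) := by
      intro j
      simp only [mulVec, dotProduct, Fin.sum_univ_three, transpose_apply]
      push_cast
      rw [← hB, ← hB, ← hB, hq]
      push_cast
      ring
    have h1 : (∀ j, q ∣ (fun i => B i j) ⬝ᵥ z) ↔
        (fun i => (z i : ℝ)) ∈ scaleDown q (scaledNeighbor Φ q ξ ξ') := by
      rw [hΛ]
      constructor
      · intro hall
        choose w hw using hall
        refine ⟨w, funext fun j => ?_⟩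
        have := hcoord j
        rw [hw j] at this
        push_cast at this
        exact mul_left_cancel₀ hq0' this
      · rintro ⟨w, hw⟩ j
        refine ⟨w j, ?_⟩
        have := hcoord j
        rw [hw] at this
        simp only at this
        exact_mod_cast this.symm
    rw [h1, mem_scaleDown]
    have h2 : ∀ w : Fin 3 → ℤ, (∀ i, (q : ℝ) * (z i : ℝ) = w i) ↔ w = q • z := by
      intro w
      constructor
      · intro hw
        funext i
        have := hw i
        rw [Pi.smul_apply, smul_eq_mul]
        exact_mod_cast this.symm
      · rintro rfl i
        simp
    simp only [h2, exists_eq_right]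
    rw [mem_scaledNeighbor, map_zsmul, formEval_zsmul, formPolar_zsmul, sq,
      mul_dvd_mul_iff_left hq0]
    exact ⟨fun h => h.1, fun h => ⟨h, dvd_mul_right _ _⟩⟩
  refine ⟨⟨R, hR⟩, ?_, hint⟩
  rw [IsCoincidenceRotation, hint, AddSubgroup.isFiniteRelIndex_iff_relIndex_ne_zero,
    hΦ.relIndex_latticeOfForms hodd fun v => nsmul_mem_formsVanishingAt (by omega) v,
    index_formsVanishingAt hp hξ]
  exact pow_ne_zero _ hp.ne_zero

end

/-! ### The closed form of the count -/

/-- Twice the number of intersections counted by `formIntersections_card`. -/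
def doubleCount (p r : ℕ) : ℤ :=
  2 * ∑ m ∈ Finset.range (r / 3 + 1), ((p : ℤ) + 1) * p ^ (r - 2 * m - 1) +
    ∑ c ∈ Finset.range r, ((r - 3 * c - 1 : ℕ) : ℤ) *
      (if c = 0 then ((p : ℤ) + 1) * p ^ (r - 1) else ((p : ℤ) ^ 2 - 1) * p ^ (r - 2 * c - 2))

lemma doubleCount_add_three (p s : ℕ) :
    doubleCount p (s + 4) = p * doubleCount p (s + 1) +
      ((p : ℤ) + 1) * ((s + 5) * p ^ (s + 3) - s * p ^ s) := by
  have h1 : ∑ m ∈ Finset.range ((s + 4) / 3 + 1), ((p : ℤ) + 1) * p ^ (s + 4 - 2 * m - 1) =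
      p * ∑ m ∈ Finset.range ((s + 1) / 3 + 1), ((p : ℤ) + 1) * p ^ (s + 1 - 2 * m - 1) +
        ((p : ℤ) + 1) * p ^ (s + 3) := by
    rw [show (s + 4) / 3 + 1 = ((s + 1) / 3 + 1) + 1 by omega, Finset.sum_range_succ',
      Finset.mul_sum]
    congr 1
    refine Finset.sum_congr rfl fun m hm => ?_
    rw [Finset.mem_range] at hm
    rw [show s + 4 - 2 * (m + 1) - 1 = (s + 1 - 2 * m - 1) + 1 by omega, pow_succ]
    ring
  have h2 : ∑ c ∈ Finset.range (s + 4), ((s + 4 - 3 * c - 1 : ℕ) : ℤ) *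
      (if c = 0 then ((p : ℤ) + 1) * p ^ (s + 4 - 1)
        else ((p : ℤ) ^ 2 - 1) * p ^ (s + 4 - 2 * c - 2)) =
      p * ∑ c ∈ Finset.range s, ((s + 1 - 3 * (c + 1) - 1 : ℕ) : ℤ) *
        (((p : ℤ) ^ 2 - 1) * p ^ (s + 1 - 2 * (c + 1) - 2)) + s * (((p : ℤ) ^ 2 - 1) * p ^ s) +
        (s + 3) * (((p : ℤ) + 1) * p ^ (s + 3)) := by
    rw [Finset.sum_range_succ', Finset.sum_range_succ, Finset.sum_range_succ,
      Finset.sum_range_succ', Finset.mul_sum]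
    simp only [Nat.add_eq_zero_iff, one_ne_zero, and_false, if_false, if_true,
      OfNat.ofNat_ne_zero]
    rw [show s + 4 - 3 * (s + 1 + 1) - 1 = 0 by omega,
      show s + 4 - 3 * (s + 1 + 1 + 1) - 1 = 0 by omega,
      show s + 4 - 3 * (0 + 1) - 1 = s by omega, show s + 4 - 3 * 0 - 1 = s + 3 by omega,
      show s + 4 - 2 * (0 + 1) - 2 = s by omega, show s + 4 - 1 = s + 3 by omega]
    have h3 : ∀ c ∈ Finset.range s, ((s + 4 - 3 * (c + 1 + 1) - 1 : ℕ) : ℤ) *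
        (((p : ℤ) ^ 2 - 1) * p ^ (s + 4 - 2 * (c + 1 + 1) - 2)) =
        p * (((s + 1 - 3 * (c + 1) - 1 : ℕ) : ℤ) *
          (((p : ℤ) ^ 2 - 1) * p ^ (s + 1 - 2 * (c + 1) - 2))) := by
      intro c _
      rw [show s + 4 - 3 * (c + 1 + 1) - 1 = s + 1 - 3 * (c + 1) - 1 by omega]
      rcases Nat.eq_zero_or_pos (s + 1 - 3 * (c + 1) - 1) with h0 | h0
      · rw [h0]; simp
      · rw [show s + 4 - 2 * (c + 1 + 1) - 2 = (s + 1 - 2 * (c + 1) - 2) + 1 by omega, pow_succ]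
        ring
    rw [Finset.sum_congr rfl h3]
    push_cast
    ring
  have h4 : ∑ c ∈ Finset.range (s + 1), ((s + 1 - 3 * c - 1 : ℕ) : ℤ) *
      (if c = 0 then ((p : ℤ) + 1) * p ^ (s + 1 - 1)
        else ((p : ℤ) ^ 2 - 1) * p ^ (s + 1 - 2 * c - 2)) =
      ∑ c ∈ Finset.range s, ((s + 1 - 3 * (c + 1) - 1 : ℕ) : ℤ) *
        (((p : ℤ) ^ 2 - 1) * p ^ (s + 1 - 2 * (c + 1) - 2)) +
      s * (((p : ℤ) + 1) * p ^ s) := by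
    rw [Finset.sum_range_succ']
    simp only [Nat.add_eq_zero_iff, one_ne_zero, and_false, if_false, if_true]
    rw [show s + 1 - 3 * 0 - 1 = s by omega, show s + 1 - 1 = s by omega]
  rw [doubleCount, doubleCount, h1, h2, h4]
  ring

/-- The closed form with the two terms that depend on the parity of `r` combined into one. -/
lemma doubleCount_eq (p : ℕ) (hp : 1 < p) (r : ℕ) (hr : 1 ≤ r) :
    (doubleCount p r : ℝ) = (r + 1) * (p + 1) * (p : ℝ) ^ ((r : ℤ) - 1)
      + (r - 2) * (p : ℝ) ^ ((r : ℤ) - 2)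
      + 2 * ((p : ℝ) ^ ((r : ℤ) - 1) - (p : ℝ) ^ ((r : ℤ) - 2 * (r / 3 : ℕ) - 1)) / (p ^ 2 - 1)
      + ((p : ℝ) ^ (4 * ((r / 3 : ℕ) : ℤ) - r + 2) - (p : ℝ) ^ ((r : ℤ) - 2)) / (p ^ 2 - 1) := by
  have hp1 : (1 : ℝ) < p := by exact_mod_cast hp
  have hp0 : (p : ℝ) ≠ 0 := by positivity
  have hpp : (p : ℝ) ^ 2 - 1 ≠ 0 := by nlinarith
  induction r using Nat.strong_induction_on with
  | _ r ih =>
    obtain rfl | rfl | rfl | ⟨s, rfl⟩ :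
        r = 1 ∨ r = 2 ∨ r = 3 ∨ ∃ s, r = s + 4 := by
      rcases Nat.lt_or_ge r 4 with h | h
      · omega
      · exact Or.inr (Or.inr (Or.inr ⟨r - 4, by omega⟩))
    · simp [doubleCount, _root_.zpow_neg]
      field_simp
      ring
    · simp [doubleCount, Finset.sum_range_succ]
      ring
    · simp [doubleCount, Finset.sum_range_succ]
      field_simp
      ring
    · have h := ih (s + 1) (by omega) (by omega)
      rw [doubleCount_add_three, show (s + 4) / 3 = (s + 1) / 3 + 1 by omega]
      generalize (s + 1) / 3 = k at h ⊢
      push_cast at h ⊢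
      rw [h, show (s : ℤ) + 4 - 1 = s + 3 by ring, show (s : ℤ) + 4 - 2 = s + 2 by ring,
        show (s : ℤ) + 4 - 2 * ((k : ℤ) + 1) - 1 = (s + 1 - 2 * k - 1) + 1 by ring,
        show 4 * ((k : ℤ) + 1) - ((s : ℤ) + 4) + 2 = (4 * k - (s + 1) + 2) + 1 by ring,
        show (s : ℤ) + 1 - 1 = s by ring, show (s : ℤ) + 1 - 2 = s - 1 by ring,
        zpow_add_one₀ hp0, zpow_add_one₀ hp0, zpow_add₀ hp0, zpow_add₀ hp0, zpow_sub_one₀ hp0,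
        zpow_natCast]
      norm_cast
      push_cast
      field_simp
      ring

lemma floor_natCast_div (r n : ℕ) (hn : 0 < n) : ⌊(r : ℝ) / (n : ℝ)⌋ = ((r / n : ℕ) : ℤ) := by
  rw [← Nat.floor_div_eq_div (K := ℝ) r n, Int.natCast_floor_eq_floor (by positivity)]

lemma doubleCount_div_two_eq (p : ℕ) (hp : 1 < p) (r : ℕ) (hr : 1 ≤ r) :
    (doubleCount p r : ℝ) / 2 =
        ((r : ℝ) / 2 + 1 / 2) * ((p : ℝ) + 1) * (p : ℝ) ^ ((r : ℤ) - 1)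
        + ((r : ℝ) / 2 - 1) * (p : ℝ) ^ ((r : ℤ) - 2)
        - ((r : ℝ) / 2 - (⌊(r : ℝ) / 2⌋ : ℝ)) * (p : ℝ) ^ ((r : ℤ) - 4)
        + ((p : ℝ) ^ ((r : ℤ) - 1) - (p : ℝ) ^ ((r : ℤ) - 2 * ⌊(r : ℝ) / 3⌋ - 1))
            / ((p : ℝ) ^ 2 - 1)
        + ((p : ℝ) ^ (4 * ⌊(r : ℝ) / 3⌋ - (r : ℤ) + 2)
            - (p : ℝ) ^ (4 * ⌊(r : ℝ) / 2⌋ - (r : ℤ) - 2))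
            / (2 * ((p : ℝ) ^ 2 - 1)) := by
  have hp1 : (1 : ℝ) < p := by exact_mod_cast hp
  have hp0 : (p : ℝ) ≠ 0 := by positivity
  have hpp : (p : ℝ) ^ 2 - 1 ≠ 0 := by nlinarith
  have h2 := floor_natCast_div r 2 two_pos
  have h3 := floor_natCast_div r 3 three_pos
  push_cast at h2 h3
  rw [doubleCount_eq p hp r hr]
  -- the two terms that involve `⌊r / 2⌋` have the same sum for even and odd `r`
  have hparity : ((r : ℝ) / 2 - (⌊(r : ℝ) / 2⌋ : ℝ)) * (p : ℝ) ^ ((r : ℤ) - 4) +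
      (p : ℝ) ^ (4 * ⌊(r : ℝ) / 2⌋ - (r : ℤ) - 2) / (2 * ((p : ℝ) ^ 2 - 1)) =
      (p : ℝ) ^ ((r : ℤ) - 2) / (2 * ((p : ℝ) ^ 2 - 1)) := by
    rcases Nat.even_or_odd' r with ⟨k, rfl | rfl⟩
    · have hf : ⌊((2 * k : ℕ) : ℝ) / 2⌋ = (k : ℤ) := by
        rw [show ((2 * k : ℕ) : ℝ) / 2 = (k : ℤ) by push_cast; ring, Int.floor_intCast]
      rw [hf]
      push_cast
      rw [show 4 * (k : ℤ) - 2 * k - 2 = 2 * k - 2 by ring]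
      ring
    · have hf : ⌊((2 * k + 1 : ℕ) : ℝ) / 2⌋ = (k : ℤ) := by
        rw [Int.floor_eq_iff]
        push_cast
        constructor <;> linarith
      rw [hf]
      push_cast
      rw [show 4 * (k : ℤ) - (2 * k + 1) - 2 = 2 * k + 1 - 4 by ring,
        show 2 * (k : ℤ) + 1 - 2 = (2 * k + 1 - 4) + 2 by ring, zpow_add₀ hp0 _ 2]
      norm_cast
      push_cast
      field_simp
      ring
  rw [h3]
  push_cast at hparity ⊢
  field_simp at hparity ⊢
  linarith

/-! ### Multiple coincidence site lattices -/

section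
variable {n : ℕ} {Γ : AddSubgroup (Fin n → ℝ)}

lemma IsMultipleCSL.of_one {R : specialOrthogonalGroup (Fin n) ℝ}
    (hR : IsCoincidenceRotation Γ R) : IsMultipleCSL Γ 1 (Γ ⊓ rotatedCopy R Γ) :=
  ⟨fun _ => R, fun _ => hR, by rw [multipleCSL, iInf_const]⟩

lemma IsMultipleCSL.of_two {R S : specialOrthogonalGroup (Fin n) ℝ}
    (hR : IsCoincidenceRotation Γ R) (hS : IsCoincidenceRotation Γ S) :
    IsMultipleCSL Γ 2 ((Γ ⊓ rotatedCopy R Γ) ⊓ (Γ ⊓ rotatedCopy S Γ)) := by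
  refine ⟨![R, S], Fin.forall_fin_two.mpr ⟨hR, hS⟩, ?_⟩
  have h : ⨅ i, rotatedCopy (![R, S] i) Γ = rotatedCopy R Γ ⊓ rotatedCopy S Γ := by
    apply le_antisymm
    · exact le_inf (iInf_le _ 0) (iInf_le _ 1)
    · exact le_iInf (Fin.forall_fin_two.mpr ⟨inf_le_left, inf_le_right⟩)
  rw [multipleCSL, h, ← inf_inf_distrib_left]

/-- A multiple CSL of index `p` or `p²` is an intersection of at most two ordinary CSLs: if it is
not ordinary itself, then two of its components that do not contain each other already have an
intersection of index at least `p²`. -/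
lemma mem_multipleCSLsAtMost_two {p : ℕ} (hp : p.Prime) {r : ℕ} (hr : r ≤ 2)
    {Λ : AddSubgroup (Fin n → ℝ)} (hΛ : Λ ∈ allMultipleCSLs Γ (p ^ r)) :
    Λ ∈ multipleCSLsAtMost Γ 2 (p ^ r) := by
  obtain ⟨⟨k, hk, R, hR, hΛR⟩, hidx⟩ := hΛ
  refine ⟨?_, hidx⟩
  have hle : ∀ i, Λ ≤ Γ ⊓ rotatedCopy (R i) Γ := fun i => by
    rw [hΛR]
    exact inf_le_inf_left _ (iInf_le _ i)
  by_cases hord : ∃ i, Λ = Γ ⊓ rotatedCopy (R i) Γ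
  · obtain ⟨i, hi⟩ := hord
    exact ⟨1, le_rfl, one_le_two, hi ▸ IsMultipleCSL.of_one (hR i)⟩
  push Not at hord
  have hΛΓ : Λ ≤ Γ := hΛR ▸ inf_le_left
  obtain ⟨i, hi⟩ : ∃ i, ¬ Γ ≤ Γ ⊓ rotatedCopy (R i) Γ := by
    by_contra! hcon
    refine hord ⟨0, hk⟩ (le_antisymm (hle _) (inf_le_left.trans ?_))
    rw [hΛR]
    exact le_inf le_rfl (le_iInf fun i => (hcon i).trans inf_le_right)
  obtain ⟨j, hj⟩ : ∃ j, ¬ Γ ⊓ rotatedCopy (R i) Γ ≤ Γ ⊓ rotatedCopy (R j) Γ := by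
    by_contra! hcon
    refine hord i (le_antisymm (hle i) ?_)
    rw [hΛR]
    exact le_inf inf_le_left (le_iInf fun j => (hcon j).trans inf_le_right)
  set C := Γ ⊓ rotatedCopy (R i) Γ with hC
  set D := C ⊓ (Γ ⊓ rotatedCopy (R j) Γ) with hD
  have hDC : D ≤ C := inf_le_left
  have hCΓ : C ≤ Γ := inf_le_left
  have hΛD : Λ ≤ D := le_inf (hle i) (hle j)
  obtain ⟨a, -, ha⟩ := (Nat.dvd_prime_pow hp).mp
    (hidx ▸ AddSubgroup.relIndex_dvd_of_le_left Γ (hle i))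
  obtain ⟨b, hbr, hb⟩ := (Nat.dvd_prime_pow hp).mp
    (hidx ▸ AddSubgroup.relIndex_dvd_of_le_left Γ hΛD)
  have hmul := AddSubgroup.relIndex_mul_relIndex D C Γ hDC hCΓ
  have hmul' := AddSubgroup.relIndex_mul_relIndex Λ D Γ hΛD (hDC.trans hCΓ)
  have ha0 : a ≠ 0 := by
    rintro rfl
    exact hi (AddSubgroup.relIndex_eq_one.mp ha)
  have hab : a ≠ b := by
    rintro rfl
    have hpos : 0 < C.relIndex Γ := ha ▸ pow_pos hp.pos a
    rw [hb, ← ha] at hmul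
    have h1 : D.relIndex C = 1 := Nat.eq_of_mul_eq_mul_right hpos (by rw [hmul, one_mul])
    exact hj ((AddSubgroup.relIndex_eq_one.mp h1).trans inf_le_right)
  have hle' : a ≤ b := by
    have : p ^ a ∣ p ^ b := ⟨D.relIndex C, by rw [← hb, ← hmul, ha, mul_comm]⟩
    exact (Nat.pow_dvd_pow_iff_le_right hp.one_lt).mp this
  obtain rfl : b = r := by omega
  have hpos : 0 < D.relIndex Γ := hb ▸ pow_pos hp.pos b
  have h1 : Λ.relIndex D = 1 :=
    Nat.eq_of_mul_eq_mul_right hpos (by rw [hmul', hidx, hb, one_mul])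
  have hΛeq : Λ = D := le_antisymm hΛD (AddSubgroup.relIndex_eq_one.mp h1)
  exact ⟨2, one_le_two, le_rfl, hΛeq ▸ IsMultipleCSL.of_two (hR i) (hR j)⟩

end

/-- Under an isometry of `ℤ³` modulo a high power of `p` with the binary quadratic forms, the
intersections of at most two ordinary CSLs correspond to the intersections of two groups of forms
vanishing at points. -/
theorem multipleCSLsAtMost_two_eq_image {p N r : ℕ} (hp : p.Prime) (hodd : Odd p)
    {Φ : (Fin 3 → ℤ) →+ ℤ × ℤ × ℤ} (hΦ : IsFormIsometry p N Φ) (hN : 2 * r ≤ N) :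
    multipleCSLsAtMost bccLattice 2 (p ^ r) = latticeOfForms Φ '' formIntersections p r := by
  have hindex : ∀ {ξ η : ℤ × ℤ} {n l : ℕ}, n ≤ N → l ≤ N →
      (latticeOfForms Φ (formsVanishingAt p ξ n ⊓ formsVanishingAt p η l)).relIndex bccLattice =
        (formsVanishingAt p ξ n ⊓ formsVanishingAt p η l).index := fun hn hl =>
    hΦ.relIndex_latticeOfForms hodd fun v => AddSubgroup.mem_inf.mpr
      ⟨nsmul_mem_formsVanishingAt hn v, nsmul_mem_formsVanishingAt hl v⟩
  ext Λ
  constructor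
  · rintro ⟨⟨k, hk1, hk2, R, hR, hΛ⟩, hidx⟩
    have hmem : ∀ i, ∀ x ∈ bccLattice, (p ^ r : ℕ) • x ∈ rotatedCopy (R i) bccLattice := by
      intro i x hx
      have h1 : (p ^ r : ℕ) • x ∈ Λ := hidx ▸ AddSubgroup.nsmul_relIndex_mem Λ hx
      rw [hΛ] at h1
      exact iInf_le (fun i => rotatedCopy (R i) bccLattice) i h1.2
    choose ξ n hn hξ hCSL using fun i =>
      exists_point_of_rotation hp hodd hΦ (by omega : r ≤ N) (hmem i)
    have hpair : ∃ i j, Λ =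
        (bccLattice ⊓ rotatedCopy (R i) bccLattice) ⊓
          (bccLattice ⊓ rotatedCopy (R j) bccLattice) := by
      obtain rfl | rfl : k = 1 ∨ k = 2 := by omega
      · refine ⟨0, 0, ?_⟩
        rw [hΛ, multipleCSL, inf_idem]
        congr 1
        exact le_antisymm (iInf_le _ 0) (le_iInf fun i => by rw [Subsingleton.elim i 0])
      · refine ⟨0, 1, ?_⟩
        rw [hΛ, multipleCSL, ← inf_inf_distrib_left]
        congr 1
        exact le_antisymm (le_inf (iInf_le _ 0) (iInf_le _ 1))
          (le_iInf (Fin.forall_fin_two.mpr ⟨inf_le_left, inf_le_right⟩))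
    obtain ⟨i, j, hij⟩ := hpair
    rw [hCSL, hCSL, ← latticeOfForms_inf] at hij
    refine ⟨_, ⟨?_, ξ i, ξ j, n i, n j, hξ i, hξ j, rfl⟩, hij.symm⟩
    rw [← hidx, hij, hindex ((hn i).trans (by omega)) ((hn j).trans (by omega))]
  · rintro ⟨G, ⟨hidx, ξ, η, n, l, hξ, hη, rfl⟩, rfl⟩
    have hle : ∀ {ζ : ℤ × ℤ} {m : ℕ}, IsCoprime ζ.1 ζ.2 →
        formsVanishingAt p ξ n ⊓ formsVanishingAt p η l ≤ formsVanishingAt p ζ m → m ≤ r := by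
      intro ζ m hζ h
      have h1 := AddSubgroup.index_dvd_of_le h
      rw [hidx, index_formsVanishingAt hp hζ] at h1
      exact (Nat.pow_dvd_pow_iff_le_right hp.one_lt).mp h1
    have hn : n ≤ r := hle hξ inf_le_left
    have hl : l ≤ r := hle hη inf_le_right
    obtain ⟨R, hR, hRξ⟩ := exists_rotation_of_point hp hodd hΦ (by omega : 2 * n ≤ N) hξ
    obtain ⟨S, hS, hSη⟩ := exists_rotation_of_point hp hodd hΦ (by omega : 2 * l ≤ N) hη
    refine ⟨⟨2, one_le_two, le_rfl, ?_⟩, ?_⟩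
    · rw [latticeOfForms_inf, ← hRξ, ← hSη]
      exact IsMultipleCSL.of_two hR hS
    · rw [hindex (by omega) (by omega), hidx]

theorem ncard_multipleCSLsAtMost_two {p r : ℕ} (hp : p.Prime) (hodd : Odd p) (hr : 1 ≤ r) :
    (multipleCSLsAtMost bccLattice 2 (p ^ r)).Finite ∧
      2 * ((multipleCSLsAtMost bccLattice 2 (p ^ r)).ncard : ℤ) = doubleCount p r := by
  obtain ⟨Φ, hΦ⟩ := exists_isFormIsometry hp hodd (2 * r)
  obtain ⟨hfin, hcard⟩ := formIntersections_card hp hr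
  rw [multipleCSLsAtMost_two_eq_image hp hodd hΦ le_rfl]
  have hmem : ∀ G ∈ formIntersections p r, ∀ v, (p ^ (2 * r) : ℕ) • v ∈ G := by
    rintro G ⟨hidx, -⟩ v
    have h1 := AddSubgroup.nsmul_index_mem G v
    rw [hidx] at h1
    rw [two_mul, pow_add, mul_nsmul]
    exact G.nsmul_mem h1 _
  have hinj : Set.InjOn (latticeOfForms Φ) (formIntersections p r) := fun G hG G' hG' h =>
    hΦ.latticeOfForms_injOn hodd (hmem G hG) (hmem G' hG') h
  exact ⟨hfin.image _, by rw [hinj.ncard_image, hcard, doubleCount]⟩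

theorem mainTheorem1 (p : ℕ) (hp : p.Prime) (hodd : Odd p) :
    (∀ r : ℕ, 1 ≤ r →
      (multipleCSLsAtMost bccLattice 2 (p ^ r)).Finite ∧
      ((multipleCSLsAtMost bccLattice 2 (p ^ r)).ncard : ℝ) =
        ((r : ℝ) / 2 + 1 / 2) * ((p : ℝ) + 1) * (p : ℝ) ^ ((r : ℤ) - 1)
        + ((r : ℝ) / 2 - 1) * (p : ℝ) ^ ((r : ℤ) - 2)
        - ((r : ℝ) / 2 - (⌊(r : ℝ) / 2⌋ : ℝ)) * (p : ℝ) ^ ((r : ℤ) - 4)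
        + ((p : ℝ) ^ ((r : ℤ) - 1) - (p : ℝ) ^ ((r : ℤ) - 2 * ⌊(r : ℝ) / 3⌋ - 1))
            / ((p : ℝ) ^ 2 - 1)
        + ((p : ℝ) ^ (4 * ⌊(r : ℝ) / 3⌋ - (r : ℤ) + 2)
            - (p : ℝ) ^ (4 * ⌊(r : ℝ) / 2⌋ - (r : ℤ) - 2))
            / (2 * ((p : ℝ) ^ 2 - 1))) ∧
    (∀ r : ℕ, r = 1 ∨ r = 2 →
      (∀ m : ℕ, 2 ≤ m →
        (multipleCSLsAtMost bccLattice 2 (p ^ r)).ncard =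
          (multipleCSLsAtMost bccLattice m (p ^ r)).ncard) ∧
      (multipleCSLsAtMost bccLattice 2 (p ^ r)).ncard =
        (allMultipleCSLs bccLattice (p ^ r)).ncard) := by

  refine ⟨fun r hr => ?_, fun r hr => ?_⟩
  · obtain ⟨hfin, hcard⟩ := ncard_multipleCSLsAtMost_two hp hodd hr
    refine ⟨hfin, ?_⟩
    rw [← doubleCount_div_two_eq p hp.one_lt r hr, ← hcard]
    push_cast
    ring
  · have hr2 : r ≤ 2 := by omega
    refine ⟨fun m hm => congrArg Set.ncard (Set.Subset.antisymm ?_ ?_),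
      congrArg Set.ncard (Set.Subset.antisymm ?_ ?_)⟩
    · rintro Λ ⟨⟨k, hk, hk2, hΛ⟩, hidx⟩
      exact ⟨⟨k, hk, hk2.trans hm, hΛ⟩, hidx⟩
    · rintro Λ ⟨⟨k, hk, -, hΛ⟩, hidx⟩
      exact mem_multipleCSLsAtMost_two hp hr2 ⟨⟨k, hk, hΛ⟩, hidx⟩
    · rintro Λ ⟨⟨k, hk, -, hΛ⟩, hidx⟩
      exact ⟨⟨k, hk, hΛ⟩, hidx⟩
    · exact fun Λ hΛ => mem_multipleCSLsAtMost_two hp hr2 hΛ
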